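/- Let $\mathbb Q\langle d,j,y\rangle$ be the noncommutative polynomial ring with $dj=jd=1$; its basis consists of the (reduced) words $j^{k_1}y\,j^{k_2}y\cdots y\,j^{k_r}$ with $r\ge 1$, $k_i\in\mathbb Z$, where $j^{-k}=d^{k}$. Let $\diamond$ be the bilinear product on it given on reduced words, by recursion on their first letters, by $1\diamond w=w\diamond 1=w$ and $$yu\diamond v=u\diamond yv=y(u\diamond v),\quad ju\diamond jv=j(u\diamond jv)+j(ju\diamond v),\quad du\diamond dv=d(u\diamond dv)-u\diamond d^2v,$$ $$du\diamond jv=d(u\diamond jv)-u\diamond v,\quad ju\diamond dv=d(ju\diamond v)-u\diamond v .$$ Let $\mathcal T$ be the span of the words $j^{k_1}y\cdots yj^{k_r}$ with $k_r\ne0$, and let $\mathcal L$ be the two-sided ideal of $(\mathbb Q\langle d,j,y\rangle,\diamond)$ generated by the elements $j^k\{d(u\diamond v)-du\diamond v-u\diamond dv\}$ with $k\in\mathbb Z$ and $u,v$ words ending in $y$. Put $$\mathcal H_-=\mathbb Q\langle d,y\rangle/(\mathcal T_-+\mathcal L_-),\qquad \mathcal T_-=\mathbb Q\langle d,y\rangle\cap\mathcal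 T,\quad \mathcal L_-=\mathbb Q\langle d,y\rangle\cap\mathcal L .$$ Let $\Delta_0$ be the coproduct on $\mathcal H_-$ induced by the homomorphism $\mathbb Q\langle d,y\rangle\to\mathbb Q\langle d,y\rangle^{\otimes 2}$ of concatenation algebras for which $d$ and $y$ are primitive, and let $\varepsilon$ be its counit ($\varepsilon(1)=1$, and $\varepsilon(w)=0$ for every nonempty word $w$). For $\mathbb Q$-linear maps $\alpha,\beta$ from $\mathcal H_-$ to the field $\mathbb Q((z))$ of formal Laurent series let $\alpha*\beta=m\circ(\alpha\otimes\beta)\circ\Delta_0$ be their convolution product. **Theorem.** Let $f(z)=\sum_{n\ge -N}b_nz^n\in\mathbb Q((z))$, let $f_{\ge0}(z)=\sum_{n\ge0}b_nz^n$, and let $\phi:\mathcal H_-\to\mathbb Q((z))$ be the $\mathbb Q$-linear map with $\phi(1)=1$ and $$\phi(d^{k_1}y\cdots d^{k_r}y)=\partial_z^{k_1}\bigl[f\,\partial_z^{k_2}[f\cdots\partial_z^{k_r}[f]\cdots]\bigr]\qquad(r\ge1,\ k_1,\dots,k_r\ge0).$$ There is exactly one pair of $\mathbb Q$-linear maps $\phi_-:\mathcal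 H_-\to\mathbb Q[z^{-1}]$ and $\phi_+:\mathcal H_-\to\mathbb Q[[z]]$ with $\phi_-(1)=1$, $\phi_-(\ker\varepsilon)\subset z^{-1}\mathbb Q[z^{-1}]$ and $\phi=\phi_-^{*-1}*\phi_+$ (the algebraic Birkhoff decomposition of $\phi$). With $$F(k_1,\dots,k_r)=\lim_{z\to0}\phi_+(d^{k_r}y\cdots d^{k_1}y)$$ (the constant coefficient), for every $r\ge1$ one has in $\mathbb Q[[z_1,\dots,z_r]]$ $$\sum_{k_1,\dots,k_r\ge0}\frac{z_1^{k_1}\cdots z_r^{k_r}}{k_1!\cdots k_r!}F(k_1,\dots,k_r)=f_{\ge0}(z_r)\,f_{\ge0}(z_{r-1}+z_r)\cdots f_{\ge0}(z_1+\cdots+z_r).$$ -/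

import Mathlib

namespace ShuffleRenorm

/-- The words in the letters `d, j, y` modulo `dj = jd = 1`.  With `d = j⁻¹`, every such word is
uniquely `j^{k₁} y j^{k₂} y ⋯ y j^{kᵣ}` with `r ≥ 1` and `k₁, …, kᵣ ∈ ℤ`; it is encoded as
`(k₁, [k₂, …, kᵣ])`.  The empty word `1` is `(0, [])`, and the letter `y` occurs as often as
the list is long. -/
abbrev Word : Type := ℤ × List ℤ

namespace Word

/-- The last exponent `kᵣ`. -/
def lastExp (w : Word) : ℤ := w.2.getLastD w.1

/-- `w` contains the letter `y` and its last letter is `y`. -/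
def EndsInY (w : Word) : Prop := w.2 ≠ [] ∧ w.lastExp = 0

/-- A size of words, used only for termination of the recursion defining the product. -/
def weight (w : Word) : ℕ := w.1.natAbs + (w.2.map fun k => k.natAbs + 1).sum

end Word

/-- The vector space underlying `ℚ⟨d, j, y⟩` (with `dj = jd = 1`); words are a basis. -/
abbrev PolyDJY : Type := Word →₀ ℚ

noncomputable section

/-- A word as a basis vector. -/
def word (w : Word) : PolyDJY := Finsupp.single w 1

/-- Left multiplication by `j^n`, for `n ∈ ℤ`. -/
def jPow (n : ℤ) : PolyDJY →ₗ[ℚ] PolyDJY :=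
  Finsupp.lmapDomain ℚ ℚ fun w : Word => ((n + w.1, w.2) : Word)

/-- Left multiplication by `j`. -/
def mulJ : PolyDJY →ₗ[ℚ] PolyDJY := jPow 1
/-- Left multiplication by `d = j⁻¹`. -/
def mulD : PolyDJY →ₗ[ℚ] PolyDJY := jPow (-1)
/-- Left multiplication by `y`. -/
def mulY : PolyDJY →ₗ[ℚ] PolyDJY :=
  Finsupp.lmapDomain ℚ ℚ fun w : Word => ((0, w.1 :: w.2) : Word)

/-- The product `u ⧢₀ v` of two reduced words, by recursion on their first letters:
`1 ⧢₀ w = w ⧢₀ 1 = w`, `yu ⧢₀ v = u ⧢₀ yv = y (u ⧢₀ v)`,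
`ju ⧢₀ jv = j (u ⧢₀ jv) + j (ju ⧢₀ v)`, `ju ⧢₀ dv = d (ju ⧢₀ v) - u ⧢₀ v`,
`du ⧢₀ jv = d (u ⧢₀ jv) - u ⧢₀ v`, `du ⧢₀ dv = d (u ⧢₀ dv) - u ⧢₀ d²v`. -/
def shWord : Word → Word → PolyDJY
  | (a, l), (b, m) =>
    if _ : a = 0 then
      match l with
      | [] => word (b, m)
      | a' :: l' => mulY (shWord (a', l') (b, m))
    else if _ : b = 0 then
      match m with
      | [] => word (a, l)
      | b' :: m' => mulY (shWord (a, l) (b', m'))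
    else if 0 < a then
      if 0 < b then
        mulJ (shWord (a - 1, l) (b, m)) + mulJ (shWord (a, l) (b - 1, m))
      else
        mulD (shWord (a, l) (b + 1, m)) - shWord (a - 1, l) (b + 1, m)
    else
      if 0 < b then
        mulD (shWord (a + 1, l) (b, m)) - shWord (a + 1, l) (b - 1, m)
      else
        mulD (shWord (a + 1, l) (b, m)) - shWord (a + 1, l) (b - 1, m)
  termination_by u v => (u.weight + v.weight, u.weight)
  decreasing_by
    all_goals
      simp only [Word.weight, List.map_cons, List.sum_cons, Prod.lex_def]
      omega

theorem shWord_one_left (v : Word) : shWord (0, []) v = word v := by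
  obtain ⟨b, m⟩ := v
  rw [shWord.eq_def]; simp

theorem shWord_y_left (a : ℤ) (l : List ℤ) (v : Word) :
    shWord (0, a :: l) v = mulY (shWord (a, l) v) := by
  obtain ⟨b, m⟩ := v
  rw [shWord.eq_def]; simp

theorem shWord_one_right (a : ℤ) (l : List ℤ) (ha : a ≠ 0) :
    shWord (a, l) (0, []) = word (a, l) := by
  rw [shWord.eq_def]; simp [ha]

theorem shWord_y_right (a : ℤ) (l : List ℤ) (ha : a ≠ 0) (b : ℤ) (m : List ℤ) :
    shWord (a, l) (0, b :: m) = mulY (shWord (a, l) (b, m)) := by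
  rw [shWord.eq_def]; simp [ha]

theorem shWord_j_j (a : ℤ) (l : List ℤ) (ha : 0 < a) (b : ℤ) (m : List ℤ) (hb : 0 < b) :
    shWord (a, l) (b, m) =
      mulJ (shWord (a - 1, l) (b, m)) + mulJ (shWord (a, l) (b - 1, m)) := by
  rw [shWord.eq_def]; simp [ha, hb, ha.ne', hb.ne']

theorem shWord_j_d (a : ℤ) (l : List ℤ) (ha : 0 < a) (b : ℤ) (m : List ℤ) (hb : b < 0) :
    shWord (a, l) (b, m) =
      mulD (shWord (a, l) (b + 1, m)) - shWord (a - 1, l) (b + 1, m) := by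
  rw [shWord.eq_def]; simp [ha, hb.ne, ha.ne', hb.not_gt]

theorem shWord_d (a : ℤ) (l : List ℤ) (ha : a < 0) (b : ℤ) (m : List ℤ) (hb : b ≠ 0) :
    shWord (a, l) (b, m) =
      mulD (shWord (a + 1, l) (b, m)) - shWord (a + 1, l) (b - 1, m) := by
  rw [shWord.eq_def]; simp [ha.ne, hb, ha.not_gt]


theorem jPow_word (n : ℤ) (w : Word) : jPow n (word w) = word (n + w.1, w.2) := by
  simp [jPow, word]

theorem mulD_word (w : Word) : mulD (word w) = word (-1 + w.1, w.2) := jPow_word _ _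

theorem mulJ_word (w : Word) : mulJ (word w) = word (1 + w.1, w.2) := jPow_word _ _

theorem mulY_word (w : Word) : mulY (word w) = word (0, w.1 :: w.2) := by
  simp [mulY, word]

/-- The product `⧢₀`, bilinearly extended to `ℚ⟨d, j, y⟩`. -/
def sh : PolyDJY →ₗ[ℚ] PolyDJY →ₗ[ℚ] PolyDJY :=
  Finsupp.linearCombination ℚ fun u => Finsupp.linearCombination ℚ (shWord u)

theorem sh_word (u v : Word) : sh (word u) (word v) = shWord u v := by
  simp [sh, word]

/-- Two-sided ideals of the nonassociative algebra `(ℚ⟨d, j, y⟩, ⧢₀)`. -/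
def IsTwoSidedIdeal (I : Submodule ℚ PolyDJY) : Prop :=
  ∀ x ∈ I, ∀ a, sh a x ∈ I ∧ sh x a ∈ I

/-- The elements `j^k {d(u ⧢₀ v) - du ⧢₀ v - u ⧢₀ dv}` with `k ∈ ℤ` and `u, v` words ending
in `y`. -/
def leibnizRelations : Set PolyDJY :=
  {x | ∃ (k : ℤ) (u v : Word), u.EndsInY ∧ v.EndsInY ∧
    x = jPow k (mulD (sh (word u) (word v)) - sh (mulD (word u)) (word v)
      - sh (word u) (mulD (word v)))}

/-- The two-sided ideal `𝓛` generated by the Leibniz relations. -/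
def idealL : Submodule ℚ PolyDJY :=
  sInf {I | IsTwoSidedIdeal I ∧ leibnizRelations ⊆ I}

/-- The subspace `𝓣` spanned by the words `j^{k₁} y ⋯ y j^{kᵣ}` with `kᵣ ≠ 0`. -/
def spaceT : Submodule ℚ PolyDJY :=
  Submodule.span ℚ (word '' {w | w.lastExp ≠ 0})

/-- The two letters of `ℚ⟨d, y⟩`. -/
inductive Letter
  | d
  | y

/-- The noncommutative polynomial ring `ℚ⟨d, y⟩` (with concatenation as product). -/
abbrev PolyDY : Type := FreeAlgebra ℚ Letter

/-- The variable `d`. -/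
def dd : PolyDY := FreeAlgebra.ι ℚ Letter.d
/-- The variable `y`. -/
def yy : PolyDY := FreeAlgebra.ι ℚ Letter.y

/-- Given operators `D` and `Y` on `B`, the action of `ℚ⟨d, y⟩` on `B` in which `d` acts as `D`
and `y` as `Y`. -/
def letterAction {B : Type*} [AddCommGroup B] [Module ℚ B] (D Y : B →ₗ[ℚ] B) :
    PolyDY →ₐ[ℚ] Module.End ℚ B :=
  FreeAlgebra.lift ℚ fun
    | Letter.d => D
    | Letter.y => Y

/-- The inclusion `ℚ⟨d, y⟩ ⊆ ℚ⟨d, j, y⟩`, a word in `d, y` being multiplied out on `1`. -/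
def inclusion : PolyDY →ₗ[ℚ] PolyDJY :=
  LinearMap.applyₗ (word (0, [])) ∘ₗ (letterAction mulD mulY).toLinearMap

/-- `𝓣₋ + 𝓛₋`, where `𝓣₋ = ℚ⟨d, y⟩ ∩ 𝓣` and `𝓛₋ = ℚ⟨d, y⟩ ∩ 𝓛`. -/
def idealTL : Submodule ℚ PolyDY := spaceT.comap inclusion ⊔ idealL.comap inclusion

/-- `𝓗₋ = ℚ⟨d, y⟩ / (𝓣₋ + 𝓛₋)`. -/
abbrev HMinus : Type := PolyDY ⧸ idealTL

section action
variable {B : Type*} [AddCommGroup B] [Module ℚ B] (D Y : B →ₗ[ℚ] B)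

@[simp] theorem letterAction_dd : letterAction D Y dd = D := by simp [letterAction, dd]
@[simp] theorem letterAction_yy : letterAction D Y yy = Y := by simp [letterAction, yy]

theorem PolyDY.induct {C : PolyDY → Prop} (h1 : ∀ c : ℚ, C (algebraMap ℚ PolyDY c))
    (hd : C dd) (hy : C yy) (hm : ∀ a b, C a → C b → C (a * b))
    (ha : ∀ a b, C a → C b → C (a + b)) (p : PolyDY) : C p := by
  induction p using FreeAlgebra.induction with
  | grade0 r => exact h1 r
  | grade1 x => cases x <;> assumption
  | mul a b h1 h2 => exact hm _ _ h1 h2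
  | add a b h1 h2 => exact ha _ _ h1 h2

theorem letterAction_intertwine {B' : Type*} [AddCommGroup B'] [Module ℚ B']
    (D' Y' : B' →ₗ[ℚ] B') (g : B →ₗ[ℚ] B') (hD : ∀ b, g (D b) = D' (g b))
    (hY : ∀ b, g (Y b) = Y' (g b)) (p : PolyDY) :
    ∀ b, g (letterAction D Y p b) = letterAction D' Y' p (g b) := by
  induction p using PolyDY.induct with
  | h1 c => intro b; simp [Module.algebraMap_end_apply]
  | hd => simpa using hD
  | hy => simpa using hY
  | hm a b h1 h2 => intro x; simp [h1, h2]
  | ha a b h1 h2 => intro x; simp [h1, h2]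

theorem letterAction_mem (K : Submodule ℚ B) (hD : ∀ b ∈ K, D b ∈ K)
    (hY : ∀ b ∈ K, Y b ∈ K) (p : PolyDY) : ∀ b ∈ K, letterAction D Y p b ∈ K := by
  induction p using PolyDY.induct with
  | h1 c => intro b hb; simpa [Module.algebraMap_end_apply] using K.smul_mem c hb
  | hd => simpa using hD
  | hy => simpa using hY
  | hm a b h1 h2 => intro x hx; simpa using h1 _ (h2 _ hx)
  | ha a b h1 h2 => intro x hx; simpa using K.add_mem (h1 _ hx) (h2 _ hx)

end action

theorem inclusion_apply (p : PolyDY) :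
    inclusion p = letterAction mulD mulY p (word (0, [])) := rfl

theorem inclusion_mul (p q : PolyDY) :
    inclusion (p * q) = letterAction mulD mulY p (inclusion q) := by
  simp [inclusion_apply]

/-- The linear map on `ℚ⟨d, y⟩` with `1 ↦ 1` and
`d^{k₁} y ⋯ d^{kᵣ} y ↦ D^{k₁}[f D^{k₂}[f ⋯ D^{kᵣ}[f] ⋯ ]]`: the letter `d` acts as `D`, the
letter `y` as multiplication by `f`, and the word is applied to `1`. -/
def iterated {B : Type*} [CommRing B] [Algebra ℚ B] (D : B →ₗ[ℚ] B) (f : B) :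
    PolyDY →ₗ[ℚ] B :=
  LinearMap.applyₗ 1 ∘ₗ (letterAction D (LinearMap.mulLeft ℚ f)).toLinearMap

theorem iterated_apply {B : Type*} [CommRing B] [Algebra ℚ B] (D : B →ₗ[ℚ] B) (f : B)
    (p : PolyDY) : iterated D f p = letterAction D (LinearMap.mulLeft ℚ f) p 1 := rfl

/-! ### Auxiliary facts on the product

The aim of this and the next sections is `idealTL_eq_ker`, which says that `𝓗₋` is the free
differential polynomial ring on one generator; it is what makes the coproduct and the character
below well defined on the quotient `𝓗₋`. -/

theorem span_induct {s : Set Word} (K : Submodule ℚ PolyDJY) (h : ∀ w ∈ s, word w ∈ K)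
    {x : PolyDJY} (hx : x ∈ Submodule.span ℚ (word '' s)) : x ∈ K := by
  refine (Submodule.span_le.2 ?_) hx
  rintro _ ⟨w, hw, rfl⟩
  exact h w hw

theorem word_mem {s : Set Word} {w : Word} (h : w ∈ s) :
    word w ∈ Submodule.span ℚ (word '' s) := Submodule.subset_span ⟨w, h, rfl⟩

theorem span_map {s t : Set Word} (g : PolyDJY →ₗ[ℚ] PolyDJY)
    (h : ∀ w ∈ s, g (word w) ∈ Submodule.span ℚ (word '' t))
    {x : PolyDJY} (hx : x ∈ Submodule.span ℚ (word '' s)) :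
    g x ∈ Submodule.span ℚ (word '' t) :=
  span_induct (Submodule.comap g (Submodule.span ℚ (word '' t))) h hx

theorem span_word_univ : Submodule.span ℚ (word '' Set.univ) = ⊤ := by
  rw [eq_top_iff]
  intro x _
  induction x using Finsupp.induction_linear with
  | zero => exact Submodule.zero_mem _
  | add f g hf hg => exact Submodule.add_mem _ (hf trivial) (hg trivial)
  | single w c =>
    have : (Finsupp.single w c : PolyDJY) = c • word w := by simp [word]
    rw [this]
    exact Submodule.smul_mem _ _ (word_mem trivial)

theorem hom_ext_word {B : Type*} [AddCommGroup B] [Module ℚ B] {g h : PolyDJY →ₗ[ℚ] B}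
    (H : ∀ w, g (word w) = h (word w)) : g = h := by
  apply Finsupp.lhom_ext'
  intro w
  ext
  exact H w

/-- Words that do not begin with `d`. -/
abbrev headNonneg : Set Word := {w | 0 ≤ w.1}
/-- Words in which `y` occurs `n` times. -/
abbrev hasLen (n : ℕ) : Set Word := {w | w.2.length = n}

theorem jPow_hasLen (k : ℤ) (n : ℕ) {x : PolyDJY}
    (hx : x ∈ Submodule.span ℚ (word '' hasLen n)) :
    jPow k x ∈ Submodule.span ℚ (word '' hasLen n) := by
  refine span_map (jPow k) (fun w hw => ?_) hx
  rw [jPow_word]; exact word_mem hw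

theorem mulY_hasLen (n : ℕ) {x : PolyDJY}
    (hx : x ∈ Submodule.span ℚ (word '' hasLen n)) :
    mulY x ∈ Submodule.span ℚ (word '' hasLen (n + 1)) := by
  refine span_map mulY (fun w hw => ?_) hx
  rw [mulY_word]; exact word_mem (by simpa using hw)

theorem shWord_induct (C : Word → Word → Prop)
    (one_left : ∀ v, C (0, []) v)
    (y_left : ∀ a l v, C (a, l) v → C (0, a :: l) v)
    (one_right : ∀ a l, a ≠ 0 → C (a, l) (0, []))
    (y_right : ∀ a l, a ≠ 0 → ∀ b m, C (a, l) (b, m) → C (a, l) (0, b :: m))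
    (j_j : ∀ a l b m, 0 < a → 0 < b → C (a - 1, l) (b, m) → C (a, l) (b - 1, m) →
      C (a, l) (b, m))
    (j_d : ∀ a l b m, 0 < a → b < 0 → C (a, l) (b + 1, m) → C (a - 1, l) (b + 1, m) →
      C (a, l) (b, m))
    (d_ : ∀ a l b m, a < 0 → b ≠ 0 → C (a + 1, l) (b, m) → C (a + 1, l) (b - 1, m) →
      C (a, l) (b, m)) : ∀ u v, C u v
  | (a, l), (b, m) => by
    rcases lt_trichotomy a 0 with ha | rfl | ha
    · by_cases hb : b = 0
      · subst hb
        match m with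
        | [] => exact one_right _ _ ha.ne
        | b' :: m' =>
          exact y_right _ _ ha.ne _ _ (shWord_induct C one_left y_left one_right y_right
            j_j j_d d_ (a, l) (b', m'))
      · exact d_ a l b m ha hb
          (shWord_induct C one_left y_left one_right y_right j_j j_d d_ (a + 1, l) (b, m))
          (shWord_induct C one_left y_left one_right y_right j_j j_d d_ (a + 1, l) (b - 1, m))
    · match l with
      | [] => exact one_left _
      | a' :: l' =>
        exact y_left _ _ _
          (shWord_induct C one_left y_left one_right y_right j_j j_d d_ (a', l') (b, m))
    · rcases lt_trichotomy b 0 with hb | rfl | hb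
      · exact j_d a l b m ha hb
          (shWord_induct C one_left y_left one_right y_right j_j j_d d_ (a, l) (b + 1, m))
          (shWord_induct C one_left y_left one_right y_right j_j j_d d_ (a - 1, l) (b + 1, m))
      · match m with
        | [] => exact one_right _ _ ha.ne'
        | b' :: m' =>
          exact y_right _ _ ha.ne' _ _ (shWord_induct C one_left y_left one_right y_right
            j_j j_d d_ (a, l) (b', m'))
      · exact j_j a l b m ha hb
          (shWord_induct C one_left y_left one_right y_right j_j j_d d_ (a - 1, l) (b, m))
          (shWord_induct C one_left y_left one_right y_right j_j j_d d_ (a, l) (b - 1, m))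
  termination_by u v => (u.weight + v.weight, u.weight)
  decreasing_by
    all_goals
      subst_vars
      simp only [Word.weight, List.map_cons, List.sum_cons, Prod.lex_def]
      omega

theorem shWord_headNonneg (u v : Word) (hu : 0 ≤ u.1) (hv : 0 ≤ v.1) :
    shWord u v ∈ Submodule.span ℚ (word '' headNonneg) := by
  have hY : ∀ x, mulY x ∈ Submodule.span ℚ (word '' headNonneg) := by
    intro x
    have : x ∈ Submodule.span ℚ (word '' Set.univ) := by rw [span_word_univ]; trivial
    refine span_map mulY (fun w _ => ?_) this
    rw [mulY_word]; exact word_mem (le_refl (0 : ℤ))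
  have hJ : ∀ x ∈ Submodule.span ℚ (word '' headNonneg),
      mulJ x ∈ Submodule.span ℚ (word '' headNonneg) := by
    intro x hx
    refine span_map mulJ (fun w hw => ?_) hx
    rw [mulJ_word]; exact word_mem (show (0 : ℤ) ≤ 1 + w.1 from add_nonneg zero_le_one hw)
  refine shWord_induct (fun u v => 0 ≤ u.1 → 0 ≤ v.1 →
    shWord u v ∈ Submodule.span ℚ (word '' headNonneg)) ?_ ?_ ?_ ?_ ?_ ?_ ?_ u v hu hv
  · intro v _ hv; rw [shWord_one_left]; exact word_mem hv
  · intro a l v _ _ _; rw [shWord_y_left]; exact hY _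
  · intro a l ha hu _; rw [shWord_one_right _ _ ha]; exact word_mem hu
  · intro a l ha b m _ _ _; rw [shWord_y_right _ _ ha]; exact hY _
  · intro a l b m ha hb h1 h2 hu hv
    rw [shWord_j_j _ _ ha _ _ hb]
    exact Submodule.add_mem _ (hJ _ (h1 (show 0 ≤ a - 1 by omega) hv))
      (hJ _ (h2 hu (show 0 ≤ b - 1 by omega)))
  · intro a l b m ha hb h1 h2 hu hv
    simp only at hv; omega
  · intro a l b m ha hb h1 h2 hu hv
    simp only at hu; omega

theorem shWord_hasLen (u v : Word) :
    shWord u v ∈ Submodule.span ℚ (word '' hasLen (u.2.length + v.2.length)) := by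
  refine shWord_induct (fun u v =>
    shWord u v ∈ Submodule.span ℚ (word '' hasLen (u.2.length + v.2.length)))
    ?_ ?_ ?_ ?_ ?_ ?_ ?_ u v
  · intro v; rw [shWord_one_left]; exact word_mem (by simp)
  · intro a l v h
    rw [shWord_y_left]
    have := mulY_hasLen _ h
    simp only [List.length_cons] at this ⊢
    convert this using 4; omega
  · intro a l ha; rw [shWord_one_right _ _ ha]; exact word_mem (by simp)
  · intro a l ha b m h
    rw [shWord_y_right _ _ ha]
    exact mulY_hasLen _ h
  · intro a l b m ha hb h1 h2
    rw [shWord_j_j _ _ ha _ _ hb]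
    exact Submodule.add_mem _ (jPow_hasLen _ _ h1) (jPow_hasLen _ _ h2)
  · intro a l b m ha hb h1 h2
    rw [shWord_j_d _ _ ha _ _ hb]
    exact Submodule.sub_mem _ (jPow_hasLen _ _ h1) h2
  · intro a l b m ha hb h1 h2
    rw [shWord_d _ _ ha _ _ hb]
    exact Submodule.sub_mem _ (jPow_hasLen _ _ h1) h2


/-! ### An evaluation of words of `ℚ⟨d, j, y⟩` that kills `𝓛` -/

section psi
variable {B : Type*} [CommRing B] [Algebra ℚ B] (D J : B →ₗ[ℚ] B) (f : B)

/-- The integer powers of `J`, with `D` as `J⁻¹`. -/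
def zAct : ℤ → B → B
  | Int.ofNat n => J^[n]
  | Int.negSucc n => D^[n + 1]

/-- Auxiliary evaluation of the tail of a word. -/
def tailVal : List ℤ → B
  | [] => 1
  | k :: l => f * zAct D J k (tailVal l)

/-- Evaluation of words: `j` acts as `J`, `d` as `D` and `y` as multiplication by `f`. -/
def psi : PolyDJY →ₗ[ℚ] B :=
  Finsupp.linearCombination ℚ fun w : Word => zAct D J w.1 (tailVal D J f w.2)

theorem psi_word (w : Word) : psi D J f (word w) = zAct D J w.1 (tailVal D J f w.2) := by
  simp [psi, word]

theorem zAct_zero (b : B) : zAct D J 0 b = b := rfl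

theorem zAct_succ (k : ℤ) (hk : 0 ≤ k) (b : B) : zAct D J (1 + k) b = J (zAct D J k b) := by
  obtain ⟨n, rfl⟩ := Int.eq_ofNat_of_zero_le hk
  have : (1 + (n : ℤ)) = Int.ofNat (n + 1) := by rw [Int.ofNat_eq_natCast]; push_cast; ring
  rw [this]
  exact Function.iterate_succ_apply' _ _ _

variable {D J}

theorem zAct_pred (hDJ : ∀ b, D (J b) = b) (k : ℤ) (b : B) :
    zAct D J (-1 + k) b = D (zAct D J k b) := by
  match k with
  | Int.ofNat 0 => rfl
  | Int.ofNat (n + 1) =>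
    have : (-1 + Int.ofNat (n + 1)) = Int.ofNat n := by simp
    rw [this]
    change J^[n] b = D (J^[n + 1] b)
    rw [Function.iterate_succ_apply', hDJ]
  | Int.negSucc n =>
    have : (-1 + Int.negSucc n) = Int.negSucc (n + 1) := by
      simp [Int.negSucc_eq]
    rw [this]
    exact Function.iterate_succ_apply' _ _ _

theorem psi_mulD (hDJ : ∀ b, D (J b) = b) (x : PolyDJY) :
    psi D J f (mulD x) = D (psi D J f x) := by
  have : psi D J f ∘ₗ mulD = D ∘ₗ psi D J f := by
    apply hom_ext_word
    intro w
    simp [mulD_word, psi_word, zAct_pred hDJ]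
  exact LinearMap.congr_fun this x

theorem psi_mulY (x : PolyDJY) : psi D J f (mulY x) = f * psi D J f x := by
  have : psi D J f ∘ₗ mulY = LinearMap.mulLeft ℚ f ∘ₗ psi D J f := by
    apply hom_ext_word
    intro w
    simp [mulY_word, psi_word, zAct_zero, tailVal]
  exact LinearMap.congr_fun this x

theorem psi_mulJ {x : PolyDJY} (hx : x ∈ Submodule.span ℚ (word '' headNonneg)) :
    psi D J f (mulJ x) = J (psi D J f x) := by
  have := span_induct (LinearMap.ker (psi D J f ∘ₗ mulJ - J ∘ₗ psi D J f))
    (s := headNonneg) (fun w hw => ?_) hx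
  · simpa [sub_eq_zero] using this
  · simp [mulJ_word, psi_word, zAct_succ D J w.1 hw]

theorem psi_shWord (hDJ : ∀ b, D (J b) = b) (hD : ∀ a b, D (a * b) = D a * b + a * D b)
    (hJ : ∀ a b, J a * J b = J (a * J b) + J (J a * b)) (u v : Word) :
    psi D J f (shWord u v) = psi D J f (word u) * psi D J f (word v) := by
  have hw : ∀ (a : ℤ) (l : List ℤ) (k : ℤ), -1 + k = a →
      psi D J f (word (a, l)) = D (psi D J f (word (k, l))) := by
    rintro _ l k rfl
    simp [psi_word, zAct_pred hDJ]
  have hw' : ∀ (a : ℤ) (l : List ℤ) (k : ℤ), 0 ≤ k → 1 + k = a →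
      psi D J f (word (a, l)) = J (psi D J f (word (k, l))) := by
    rintro _ l k hk rfl
    simp [psi_word, zAct_succ _ _ _ hk]
  have h1 : psi D J f (word (0, [])) = 1 := by simp [psi_word, zAct_zero, tailVal]
  have hy : ∀ (a : ℤ) (l : List ℤ),
      psi D J f (word (0, a :: l)) = f * psi D J f (word (a, l)) := by
    intro a l
    simp [psi_word, zAct_zero, tailVal]
  refine shWord_induct (fun u v => psi D J f (shWord u v) =
    psi D J f (word u) * psi D J f (word v)) ?_ ?_ ?_ ?_ ?_ ?_ ?_ u v
  · intro v; rw [shWord_one_left, h1, one_mul]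
  · intro a l v h; rw [shWord_y_left, psi_mulY, h, hy, mul_assoc]
  · intro a l ha; rw [shWord_one_right _ _ ha, h1, mul_one]
  · intro a l ha b m h; rw [shWord_y_right _ _ ha, psi_mulY, h, hy]; ring
  · intro a l b m ha hb e1 e2
    have n1 := shWord_headNonneg (a - 1, l) (b, m) (by simp; omega) (by simp; omega)
    have n2 := shWord_headNonneg (a, l) (b - 1, m) (by simp; omega) (by simp; omega)
    rw [shWord_j_j _ _ ha _ _ hb, map_add, psi_mulJ f n1, psi_mulJ f n2, e1, e2,
      hw' a l (a - 1) (by omega) (by omega), hw' b m (b - 1) (by omega) (by omega), hJ]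
  · intro a l b m ha hb e1 e2
    rw [shWord_j_d _ _ ha _ _ hb, map_sub, psi_mulD f hDJ, e1, e2, hD,
      hw (a - 1) l a (by omega), hw b m (b + 1) (by omega)]
    ring
  · intro a l b m ha hb e1 e2
    rw [shWord_d _ _ ha _ _ hb, map_sub, psi_mulD f hDJ, e1, e2, hD,
      hw a l (a + 1) (by omega), hw (b - 1) m b (by omega)]
    ring

theorem psi_sh (hDJ : ∀ b, D (J b) = b) (hD : ∀ a b, D (a * b) = D a * b + a * D b)
    (hJ : ∀ a b, J a * J b = J (a * J b) + J (J a * b)) (x y : PolyDJY) :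
    psi D J f (sh x y) = psi D J f x * psi D J f y := by
  have : (sh.compr₂ (psi D J f)) =
      (LinearMap.mul ℚ B).compl₁₂ (psi D J f) (psi D J f) := by
    apply hom_ext_word
    intro u
    apply hom_ext_word
    intro v
    simp [sh_word, psi_shWord f hDJ hD hJ]
  exact LinearMap.congr_fun₂ this x y

theorem psi_len_mem (m : Ideal B) (hDm : ∀ b ∈ m, D b ∈ m) (hJm : ∀ b ∈ m, J b ∈ m)
    (hf : f ∈ m) (n : ℕ) {x : PolyDJY}
    (hx : x ∈ Submodule.span ℚ (word '' hasLen (n + 1))) : psi D J f x ∈ m := by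
  refine span_induct ((m.restrictScalars ℚ).comap (psi D J f)) (fun w hw => ?_) hx
  obtain ⟨k, l⟩ := w
  have key : ∀ k : ℤ, ∀ b ∈ m, zAct D J k b ∈ m := by
    intro k b hb
    match k with
    | Int.ofNat n =>
      change J^[n] b ∈ m
      induction n with
      | zero => exact hb
      | succ n ih => rw [Function.iterate_succ_apply']; exact hJm _ ih
    | Int.negSucc n =>
      change D^[n + 1] b ∈ m
      generalize n + 1 = n
      induction n with
      | zero => exact hb
      | succ n ih => rw [Function.iterate_succ_apply']; exact hDm _ ih
  match l with
  | [] => simp [hasLen] at hw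
  | a :: l =>
    simp only [Submodule.mem_comap, Submodule.restrictScalars_mem, psi_word]
    exact key _ _ (m.mul_mem_right _ hf)

theorem jPow_add (k l : ℤ) (x : PolyDJY) : jPow (k + l) x = jPow k (jPow l x) := by
  have : jPow (k + l) = jPow k ∘ₗ jPow l := by
    apply hom_ext_word
    intro w
    simp [jPow_word, add_assoc]
  exact LinearMap.congr_fun this x

theorem jPow_zero (x : PolyDJY) : jPow 0 x = x := by
  have : jPow 0 = LinearMap.id := by
    apply hom_ext_word
    intro w
    simp [jPow_word]
  exact LinearMap.congr_fun this x

theorem psi_idealL (hDJ : ∀ b, D (J b) = b) (hD : ∀ a b, D (a * b) = D a * b + a * D b)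
    (hJ : ∀ a b, J a * J b = J (a * J b) + J (J a * b))
    (m : Ideal B) (hDm : ∀ b ∈ m, D b ∈ m) (hJm : ∀ b ∈ m, J b ∈ m)
    (hf : f ∈ m) (hinj : ∀ b ∈ m, D b = 0 → b = 0) {x : PolyDJY} (hx : x ∈ idealL) :
    psi D J f x = 0 := by
  have h := (Submodule.mem_sInf.1 hx) (LinearMap.ker (psi D J f)) ⟨?_, ?_⟩
  · exact h
  · intro x hx a
    rw [LinearMap.mem_ker] at hx
    simp [psi_sh f hDJ hD hJ, hx]
  · rintro _ ⟨k, u, v, ⟨hu, -⟩, -, rfl⟩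
    set g := mulD (sh (word u) (word v)) - sh (mulD (word u)) (word v)
      - sh (word u) (mulD (word v)) with hg
    have g0 : psi D J f g = 0 := by
      simp only [hg, map_sub, psi_mulD f hDJ, psi_sh f hDJ hD hJ, hD]
      ring
    have glen : g ∈ Submodule.span ℚ (word '' hasLen (u.2.length + v.2.length)) := by
      refine Submodule.sub_mem _ (Submodule.sub_mem _ ?_ ?_) ?_
      · rw [sh_word]; exact jPow_hasLen _ _ (shWord_hasLen u v)
      · rw [mulD_word, sh_word]; exact shWord_hasLen (-1 + u.1, u.2) v
      · rw [mulD_word, sh_word]; exact shWord_hasLen u (-1 + v.1, v.2)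
    have gm : ∀ k, psi D J f (jPow k g) ∈ m := by
      intro k
      obtain ⟨n, hn⟩ : ∃ n, u.2.length + v.2.length = n + 1 := by
        have := List.length_pos_iff.2 hu
        exact ⟨u.2.length + v.2.length - 1, by omega⟩
      rw [hn] at glen
      exact psi_len_mem f m hDm hJm hf n (jPow_hasLen k _ glen)
    change psi D J f (jPow k g) = 0
    induction k using Int.induction_on with
    | zero => rw [jPow_zero]; exact g0
    | succ k ih =>
      apply hinj _ (gm _)
      rw [← psi_mulD f hDJ, mulD, ← jPow_add]
      have e : (-1 + ((k : ℤ) + 1)) = k := by ring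
      rwa [e]
    | pred k ih =>
      have : (-(k : ℤ) - 1) = -1 + -(k : ℤ) := by ring
      rw [this, jPow_add]
      change psi D J f (mulD _) = 0
      rw [psi_mulD f hDJ, ih, map_zero]

theorem psi_inclusion (hDJ : ∀ b, D (J b) = b) (p : PolyDY) :
    psi D J f (inclusion p) = iterated D f p := by
  rw [inclusion_apply, iterated_apply, letterAction_intertwine mulD mulY D
    (LinearMap.mulLeft ℚ f) (psi D J f) (psi_mulD f hDJ) (psi_mulY f) p]
  simp [psi_word, zAct_zero, tailVal]

/-- The words in `d` and `y` only. -/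
abbrev dyWords : Set Word := {w | w.1 ≤ 0 ∧ ∀ k ∈ w.2, k ≤ 0}

theorem inclusion_mem (p : PolyDY) :
    inclusion p ∈ Submodule.span ℚ (word '' dyWords) := by
  rw [inclusion_apply]
  refine letterAction_mem mulD mulY _ (fun b hb => ?_) (fun b hb => ?_) p _ (word_mem (by simp))
  · refine span_map mulD (fun w hw => ?_) hb
    rw [mulD_word]
    exact word_mem ⟨by have := hw.1; simp; omega, hw.2⟩
  · refine span_map mulY (fun w hw => ?_) hb
    rw [mulY_word]
    exact word_mem ⟨le_rfl, by simpa using hw⟩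

theorem span_word_inter {s t : Set Word} {x : PolyDJY}
    (hs : x ∈ Submodule.span ℚ (word '' s)) (ht : x ∈ Submodule.span ℚ (word '' t)) :
    x ∈ Submodule.span ℚ (word '' (s ∩ t)) := by
  have e : ∀ s : Set Word, Submodule.span ℚ (word '' s) = Finsupp.supported ℚ ℚ s :=
    fun s => (Finsupp.supported_eq_span_single ℚ s).symm
  rw [e] at *
  rw [Finsupp.supported_inter]
  exact ⟨hs, ht⟩

theorem psi_spaceT (hD1 : D 1 = 0) {x : PolyDJY} (hx : x ∈ spaceT)
    (hx' : x ∈ Submodule.span ℚ (word '' dyWords)) : psi D J f x = 0 := by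
  refine span_induct (LinearMap.ker (psi D J f)) (fun w hw => ?_) (span_word_inter hx hx')
  obtain ⟨k, l⟩ := w
  obtain ⟨hT, hk, hl⟩ := hw
  have hit : ∀ n, D^[n + 1] 1 = 0 := by
    intro n
    induction n with
    | zero => simpa using hD1
    | succ n ih => rw [Function.iterate_succ_apply', ih, map_zero]
  have hz : ∀ k, zAct D J k 0 = 0 := by
    intro k
    match k with
    | Int.ofNat n => exact Function.iterate_fixed (map_zero J) n
    | Int.negSucc n => exact Function.iterate_fixed (map_zero D) _
  rw [LinearMap.mem_ker, psi_word]
  simp only at hk hl ⊢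
  induction l generalizing k with
  | nil =>
    simp only [Word.lastExp, Set.mem_ofPred_eq, List.getLastD_nil] at hT
    match k, hk, hT with
    | Int.negSucc n, _, _ => exact hit n
    | Int.ofNat n, hk, hT => simp at hk hT; omega
  | cons a l ih =>
    have e : Word.lastExp (k, a :: l) = Word.lastExp (a, l) := by
      simp only [Word.lastExp, List.getLastD_cons]
    have := ih a (show Word.lastExp (a, l) ≠ 0 from e ▸ hT)
      (hl a (by simp)) (fun b hb => hl b (by simp [hb]))
    rw [tailVal, this, mul_zero, hz]

theorem iterated_idealTL (hDJ : ∀ b, D (J b) = b) (hD : ∀ a b, D (a * b) = D a * b + a * D b)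
    (hJ : ∀ a b, J a * J b = J (a * J b) + J (J a * b))
    (m : Ideal B) (hDm : ∀ b ∈ m, D b ∈ m) (hJm : ∀ b ∈ m, J b ∈ m)
    (hf : f ∈ m) (hinj : ∀ b ∈ m, D b = 0 → b = 0) {p : PolyDY} (hp : p ∈ idealTL) :
    iterated D f p = 0 := by
  have hD1 : D 1 = 0 := by simpa using hD 1 1
  obtain ⟨a, ha, b, hb, rfl⟩ := Submodule.mem_sup.1 hp
  rw [map_add, ← psi_inclusion f hDJ, ← psi_inclusion f hDJ,
    psi_spaceT f hD1 ha (inclusion_mem a), psi_idealL f hDJ hD hJ m hDm hJm hf hinj hb, add_zero]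

end psi

/-! ### The free differential polynomial ring -/

/-- The free differential polynomial ring on one generator `X 0`, with `X n` its `n`-th
derivative. -/
abbrev DiffPoly : Type := MvPolynomial ℕ ℚ

/-- Its derivation. -/
def dX : Derivation ℚ DiffPoly DiffPoly :=
  MvPolynomial.mkDerivation ℚ fun n => MvPolynomial.X (n + 1)

theorem dX_X (n : ℕ) : dX (MvPolynomial.X n) = MvPolynomial.X (n + 1) := by simp [dX]

/-- The iterated-differential map for the generic element `X 0`. -/
def toDiffPoly : PolyDY →ₗ[ℚ] DiffPoly := iterated dX.toLinearMap (MvPolynomial.X 0)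

theorem toDiffPoly_apply (p : PolyDY) :
    toDiffPoly p = letterAction dX.toLinearMap (LinearMap.mulLeft ℚ (MvPolynomial.X 0)) p 1 := rfl

theorem iterated_eq_aeval {B : Type*} [CommRing B] [Algebra ℚ B] (D : B →ₗ[ℚ] B) (f : B)
    (hD : ∀ a b, D (a * b) = D a * b + a * D b) (p : PolyDY) :
    iterated D f p = MvPolynomial.aeval (fun n => D^[n] f) (toDiffPoly p) := by
  have hD1 : D 1 = 0 := by simpa using hD 1 1
  have hDc : ∀ c : ℚ, D (algebraMap ℚ B c) = 0 := by
    intro c; rw [Algebra.algebraMap_eq_smul_one, map_smul, hD1, smul_zero]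
  rw [toDiffPoly_apply]
  have := letterAction_intertwine dX.toLinearMap (LinearMap.mulLeft ℚ (MvPolynomial.X 0)) D
    (LinearMap.mulLeft ℚ f)
    (MvPolynomial.aeval (fun n => D^[n] f) : DiffPoly →ₐ[ℚ] B).toLinearMap
    (fun q => ?_) (fun q => ?_) p 1
  · simp only [AlgHom.toLinearMap_apply, map_one] at this
    rw [this, iterated_apply]
  · change MvPolynomial.aeval (fun n => D^[n] f) (dX q) = D (MvPolynomial.aeval (fun n => D^[n] f) q)
    induction q using MvPolynomial.induction_on with
    | C c => simp [← MvPolynomial.algebraMap_eq, hDc]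
    | add p q hp hq => simp [hp, hq]
    | mul_X p n hp =>
      rw [Derivation.leibniz, dX_X, map_mul, hD, ← hp]
      simp only [smul_eq_mul, map_add, map_mul, MvPolynomial.aeval_X,
        Function.iterate_succ_apply']
      ring
  · simp

section model
open Polynomial

/-- A right inverse of `w + d/dX` on polynomials. -/
theorem exists_rightInverse (w : ℚ) : ∃ K : ℚ[X] →ₗ[ℚ] ℚ[X],
    (∀ p, w • K p + derivative (K p) = p) ∧ (w = 0 → ∀ p, (K p).eval 0 = 0) := by
  have h : ∀ n : ℕ, ∃ q : ℚ[X], w • q + derivative q = X ^ n ∧ (w = 0 → q.eval 0 = 0) := by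
    intro n
    by_cases hw : w = 0
    · refine ⟨((n : ℚ) + 1)⁻¹ • X ^ (n + 1), ?_, ?_⟩
      · have : (n : ℚ) + 1 ≠ 0 := by positivity
        rw [hw, zero_smul, zero_add, derivative_smul, derivative_X_pow, add_tsub_cancel_right,
          ← smul_eq_C_mul, smul_smul]
        push_cast
        rw [inv_mul_cancel₀ this, one_smul]
      · intro _; simp
    · induction n with
      | zero => exact ⟨C w⁻¹, by simp [smul_C, hw], fun h => absurd h hw⟩
      | succ n ih =>
        obtain ⟨q, hq, -⟩ := ih
        refine ⟨w⁻¹ • (X ^ (n + 1) - ((n : ℚ) + 1) • q), ?_, fun h => absurd h hw⟩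
        rw [smul_smul, mul_inv_cancel₀ hw, one_smul, derivative_smul, derivative_sub,
          derivative_smul, derivative_X_pow, add_tsub_cancel_right, ← hq, ← smul_eq_C_mul]
        push_cast
        have : ((n : ℚ) + 1) • (w • q + derivative q) - ((n : ℚ) + 1) • derivative q
          = w • ((n : ℚ) + 1) • q := by module
        rw [this, smul_smul w⁻¹, inv_mul_cancel₀ hw, one_smul, sub_add_cancel]
  choose q hq1 hq2 using h
  refine ⟨(basisMonomials ℚ).constr ℚ q, ?_, ?_⟩
  · intro p
    have : w • ((basisMonomials ℚ).constr ℚ q) + derivative ∘ₗ ((basisMonomials ℚ).constr ℚ q)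
        = LinearMap.id := by
      apply (basisMonomials ℚ).ext
      intro n
      simp only [LinearMap.add_apply, LinearMap.smul_apply, LinearMap.comp_apply,
        Module.Basis.constr_basis, hq1]
      simp [X_pow_eq_monomial]
    exact LinearMap.congr_fun this p
  · intro hw p
    have : (leval 0 : ℚ[X] →ₗ[ℚ] ℚ) ∘ₗ ((basisMonomials ℚ).constr ℚ q) = 0 := by
      apply (basisMonomials ℚ).ext
      intro n
      simp [LinearMap.comp_apply, -coe_basisMonomials, Module.Basis.constr_basis, hq2 n hw,
        leval_apply]
    exact LinearMap.congr_fun this p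

theorem weighted_injective (w : ℚ) (p : ℚ[X]) (h : w • p + derivative p = 0)
    (h0 : w = 0 → p.eval 0 = 0) : p = 0 := by
  by_cases hw : w = 0
  · rw [hw, zero_smul, zero_add] at h
    have := derivative_eq_zero.1 h
    rw [eq_C_of_natDegree_eq_zero this] at h0 ⊢
    have := h0 hw
    simp at this
    simp [this]
  · by_contra hp
    have h1 : derivative p = -(w • p) := by rw [eq_neg_iff_add_eq_zero, add_comm]; exact h
    have h2 := degree_derivative_lt hp
    rw [h1, degree_neg, degree_smul_of_smul_regular p
      ((IsUnit.mk0 w hw).isSMulRegular _)] at h2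
    exact lt_irrefl _ h2

variable (N : ℕ)

/-- An auxiliary differential algebra in which the derivation has a Rota-Baxter right inverse. -/
abbrev Model : Type := MvPowerSeries (Fin N) ℚ[X]

/-- The weight of an exponent. -/
def wt (α : Fin N →₀ ℕ) : ℚ := ∑ i : Fin N, ((i : ℕ) + 1 : ℚ) * α i

variable {N}

theorem wt_add (α β : Fin N →₀ ℕ) : wt N (α + β) = wt N α + wt N β := by
  simp [wt, mul_add, Finset.sum_add_distrib]

theorem wt_eq_zero {α : Fin N →₀ ℕ} : wt N α = 0 ↔ α = 0 := by
  constructor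
  · intro h
    have := (Finset.sum_eq_zero_iff_of_nonneg (fun i _ => by positivity)).1 h
    ext i
    have := this i (Finset.mem_univ _)
    have h2 : ((i : ℕ) + 1 : ℚ) ≠ 0 := by positivity
    simpa [h2] using this
  · rintro rfl; simp [wt]

variable (N)

/-- The derivation of the model. -/
def modelD : Model N →ₗ[ℚ] Model N where
  toFun F := fun α => wt N α • F α + derivative (F α)
  map_add' F G := by
    funext α
    change wt N α • (F α + G α) + derivative (F α + G α) =
      (wt N α • F α + derivative (F α)) + (wt N α • G α + derivative (G α))
    rw [smul_add, derivative_add]; exact add_add_add_comm _ _ _ _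
  map_smul' c F := by
    funext α
    change wt N α • (c • F α) + derivative (c • F α) = c • (wt N α • F α + derivative (F α))
    rw [derivative_smul, smul_add, smul_comm]

theorem modelD_coeff (F : Model N) (α : Fin N →₀ ℕ) :
    MvPowerSeries.coeff α (modelD N F) =
      wt N α • MvPowerSeries.coeff α F + derivative (MvPowerSeries.coeff α F) := rfl

/-- Its right inverse. -/
def modelJ : Model N →ₗ[ℚ] Model N where
  toFun F := fun α => (exists_rightInverse (wt N α)).choose (F α)
  map_add' F G := by
    funext α
    exact map_add _ (F α) (G α)
  map_smul' c F := by
    funext α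
    exact map_smul _ c (F α)

theorem modelJ_coeff (F : Model N) (α : Fin N →₀ ℕ) :
    MvPowerSeries.coeff α (modelJ N F) =
      (exists_rightInverse (wt N α)).choose (MvPowerSeries.coeff α F) := rfl

theorem modelDJ (F : Model N) : modelD N (modelJ N F) = F := by
  ext1 α
  rw [modelD_coeff, modelJ_coeff]
  exact (exists_rightInverse (wt N α)).choose_spec.1 _

theorem modelD_mul (F G : Model N) :
    modelD N (F * G) = modelD N F * G + F * modelD N G := by
  classical
  ext1 α
  rw [modelD_coeff, map_add]
  simp only [MvPowerSeries.coeff_mul, derivative_sum, Finset.smul_sum, derivative_mul]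
  rw [← Finset.sum_add_distrib, ← Finset.sum_add_distrib]
  refine Finset.sum_congr rfl fun x hx => ?_
  rw [← Finset.HasAntidiagonal.mem_antidiagonal.1 hx, wt_add, modelD_coeff, modelD_coeff]
  simp only [smul_eq_C_mul, map_add]
  ring

theorem modelD_eq_zero (F : Model N) (h : modelD N F = 0)
    (h0 : (MvPowerSeries.coeff 0 F).eval 0 = 0) : F = 0 := by
  ext1 α
  rw [map_zero]
  refine weighted_injective (wt N α) _ ?_ ?_
  · rw [← modelD_coeff, h, map_zero]
  · intro h; rw [wt_eq_zero.1 h]; exact h0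

theorem modelJ_eval (F : Model N) : (MvPowerSeries.coeff 0 (modelJ N F)).eval 0 = 0 :=
  (exists_rightInverse (wt N 0)).choose_spec.2 (wt_eq_zero.2 rfl) _

theorem modelJ_mul (F G : Model N) :
    modelJ N F * modelJ N G = modelJ N (F * modelJ N G) + modelJ N (modelJ N F * G) := by
  rw [← sub_eq_zero]
  apply modelD_eq_zero
  · rw [map_sub, map_add, modelDJ, modelDJ, modelD_mul, modelDJ, modelDJ, sub_self]
  · simp only [map_sub, map_add, eval_sub, eval_add, map_mul,
      MvPowerSeries.coeff_zero_eq_constantCoeff]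
    have := modelJ_eval N F
    rw [MvPowerSeries.coeff_zero_eq_constantCoeff] at this
    have h2 := fun F => modelJ_eval N F
    simp only [MvPowerSeries.coeff_zero_eq_constantCoeff] at h2
    simp [h2]

/-- The ideal of series without constant term. -/
def modelIdeal : Ideal (Model N) := RingHom.ker (MvPowerSeries.constantCoeff (R := ℚ[X]))

theorem mem_modelIdeal (F : Model N) : F ∈ modelIdeal N ↔ MvPowerSeries.coeff 0 F = 0 := by
  rw [MvPowerSeries.coeff_zero_eq_constantCoeff]; rfl

/-- The value of `y`. -/
def modelGen : Model N := ∑ i, MvPowerSeries.X i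

theorem modelD_X (i : Fin N) :
    modelD N (MvPowerSeries.X i) = ((i : ℕ) + 1 : ℚ) • MvPowerSeries.X i := by
  classical
  ext1 α
  change _ = ((i : ℕ) + 1 : ℚ) • MvPowerSeries.coeff α (MvPowerSeries.X i : Model N)
  rw [modelD_coeff, MvPowerSeries.coeff_X]
  split_ifs with h
  · subst h
    have : wt N (Finsupp.single i 1) = (i : ℕ) + 1 := by
      simp [wt, Finsupp.single_apply]
    simp [this]
  · simp

theorem modelD_iterate_gen (k : ℕ) :
    (modelD N)^[k] (modelGen N) = ∑ i : Fin N, (((i : ℕ) + 1 : ℚ) ^ k) • MvPowerSeries.X i := by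
  induction k with
  | zero => simp [modelGen]
  | succ k ih =>
    rw [Function.iterate_succ_apply', ih, map_sum]
    refine Finset.sum_congr rfl fun i _ => ?_
    rw [map_smul, modelD_X, smul_smul, pow_succ]

theorem iterated_model_idealTL {p : PolyDY} (hp : p ∈ idealTL) :
    iterated (modelD N) (modelGen N) p = 0 := by
  refine iterated_idealTL (J := modelJ N) _ (modelDJ N) (modelD_mul N) (modelJ_mul N)
    (modelIdeal N) ?_ ?_ ?_ ?_ hp
  · intro F hF
    rw [mem_modelIdeal] at *
    rw [modelD_coeff, hF]; simp
  · intro F hF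
    rw [mem_modelIdeal] at *
    rw [modelJ_coeff, hF, map_zero]
  · rw [mem_modelIdeal, modelGen, map_sum]
    simp
  · intro F hF h
    rw [mem_modelIdeal] at hF
    exact modelD_eq_zero N F h (by rw [hF]; simp)

theorem model_aeval (q : MvPolynomial (Fin N) ℚ) :
    MvPolynomial.aeval (fun i => (MvPowerSeries.X i : Model N)) q =
      ((MvPolynomial.map C q : MvPolynomial (Fin N) ℚ[X]) : Model N) := by
  induction q using MvPolynomial.induction_on with
  | C c =>
    simp only [MvPolynomial.aeval_C, MvPolynomial.map_C, MvPolynomial.coe_C,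
      MvPowerSeries.algebraMap_apply]
    rfl
  | add p q hp hq => simp [hp, hq]
  | mul_X p n hp => simp [hp]

theorem model_separates {q : DiffPoly}
    (h : ∀ N, MvPolynomial.aeval (fun n => (modelD N)^[n] (modelGen N)) q = 0) : q = 0 := by
  apply MvPolynomial.funext
  intro a
  rw [map_zero]
  obtain ⟨N, hN⟩ : ∃ N, ∀ k ∈ q.vars, k < N :=
    ⟨q.vars.sup id + 1, fun k hk => Nat.lt_succ_of_le (Finset.le_sup (f := id) hk)⟩
  let g : DiffPoly →ₐ[ℚ] MvPolynomial (Fin N) ℚ :=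
    MvPolynomial.aeval fun k => ∑ i : Fin N, (((i : ℕ) + 1 : ℚ) ^ k) • MvPolynomial.X i
  have h1 : g q = 0 := by
    have h2 := h N
    have h3 : MvPolynomial.aeval (fun n => (modelD N)^[n] (modelGen N)) q =
        MvPolynomial.aeval (fun i => (MvPowerSeries.X i : Model N)) (g q) := by
      rw [← AlgHom.comp_apply]
      congr 1
      apply MvPolynomial.algHom_ext
      intro k
      simp [g, modelD_iterate_gen]
    rw [h3, model_aeval] at h2
    have h4 : (MvPolynomial.map C (g q) : MvPolynomial (Fin N) ℚ[X]) = 0 := by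
      apply MvPolynomial.coe_injective
      simpa using h2
    exact MvPolynomial.map_injective _ C_injective (by rw [h4, map_zero])
  let V : Matrix (Fin N) (Fin N) ℚ := Matrix.vandermonde fun i => ((i : ℕ) + 1 : ℚ)
  have hV : IsUnit V.det := by
    rw [isUnit_iff_ne_zero]
    apply Matrix.det_vandermonde_ne_zero_iff.2
    intro i j hij
    ext
    simpa using hij
  let c : Fin N → ℚ := Matrix.vecMul (fun k : Fin N => a k) V⁻¹
  have hc : ∀ k : Fin N, ∑ i : Fin N, ((i : ℕ) + 1 : ℚ) ^ (k : ℕ) * c i = a k := by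
    intro k
    have : Matrix.vecMul c V = fun k : Fin N => a k := by
      simp [c, Matrix.vecMul_vecMul, Matrix.nonsing_inv_mul _ hV]
    have := congrFun this k
    simp only [Matrix.vecMul, dotProduct, V, Matrix.vandermonde_apply] at this
    rw [← this]
    exact Finset.sum_congr rfl fun i _ => mul_comm _ _
  have h5 : MvPolynomial.eval c (g q) = 0 := by rw [h1, map_zero]
  have h6 : MvPolynomial.eval c (g q) =
      MvPolynomial.aeval (fun k : ℕ => ∑ i : Fin N, ((i : ℕ) + 1 : ℚ) ^ k * c i) q := by
    change MvPolynomial.aeval c (g q) = _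
    rw [← AlgHom.comp_apply]
    congr 1
    apply MvPolynomial.algHom_ext
    intro k
    simp [g]
  rw [← h5, h6]
  change MvPolynomial.aeval a q = _
  exact MvPolynomial.eval₂Hom_congr' rfl (fun k hk _ => (hc ⟨k, hN k hk⟩).symm) rfl

theorem toDiffPoly_idealTL {p : PolyDY} (hp : p ∈ idealTL) : toDiffPoly p = 0 := by
  apply model_separates
  intro N
  rw [← iterated_eq_aeval _ _ (modelD_mul N)]
  exact iterated_model_idealTL N hp

end model

/-! ### Every element of `ℚ⟨d, y⟩` killed by the generic evaluation lies in `𝓣₋ + 𝓛₋` -/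

section closure

/-- The words ending in `y`. -/
abbrev endsY : Set Word := {w | w.EndsInY}

theorem sh_mem_idealL {x : PolyDJY} (hx : x ∈ idealL) (a : PolyDJY) : sh a x ∈ idealL :=
  Submodule.mem_sInf.2 fun I hI => (hI.1 x (Submodule.mem_sInf.1 hx I hI) a).1

/-- The word `d^b y`. -/
def gWord (b : ℕ) : Word := (-(b : ℤ), [0])

theorem gWord_endsInY (b : ℕ) : (gWord b).EndsInY := by
  simp [gWord, Word.EndsInY, Word.lastExp]

theorem mulD_gWord (b : ℕ) : mulD (word (gWord b)) = word (gWord (b + 1)) := by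
  rw [mulD_word]; simp only [gWord]; congr 2; push_cast; ring

theorem shWord_gWord_zero (v : Word) : shWord (gWord 0) v = mulY (word v) := by
  change shWord (0, 0 :: []) v = _
  rw [shWord_y_left, shWord_one_left]

theorem shWord_gWord_y (b : ℕ) (k : ℤ) (l : List ℤ) :
    shWord (gWord b) (0, k :: l) = mulY (shWord (gWord b) (k, l)) := by
  cases b with
  | zero => rw [shWord_gWord_zero, shWord_gWord_zero, mulY_word, mulY_word, mulY_word]
  | succ b => exact shWord_y_right _ _ (by push_cast; omega) _ _

theorem sh_gWord_mulY (b : ℕ) (x : PolyDJY) :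
    sh (word (gWord b)) (mulY x) = mulY (sh (word (gWord b)) x) := by
  have : sh (word (gWord b)) ∘ₗ mulY = mulY ∘ₗ sh (word (gWord b)) := by
    apply hom_ext_word
    intro w
    simp only [LinearMap.comp_apply]
    rw [mulY_word, sh_word, sh_word, shWord_gWord_y]
  exact LinearMap.congr_fun this x

theorem sh_gWord_zero (x : PolyDJY) : sh (word (gWord 0)) x = mulY x := by
  have : sh (word (gWord 0)) = mulY := by
    apply hom_ext_word
    intro w
    rw [sh_word, shWord_gWord_zero]
  rw [this]

theorem sh_gWord_one (b : ℕ) : sh (word (gWord b)) (word (0, [])) = word (gWord b) := by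
  rw [sh_word]
  cases b with
  | zero => rw [shWord_gWord_zero, mulY_word]; rfl
  | succ b => exact shWord_one_right _ _ (by push_cast; omega)

theorem jPow_endsY (k : ℤ) {x : PolyDJY} (hx : x ∈ Submodule.span ℚ (word '' endsY)) :
    jPow k x ∈ Submodule.span ℚ (word '' endsY) := by
  refine span_map (jPow k) (fun w hw => ?_) hx
  rw [jPow_word]
  obtain ⟨a, l⟩ := w
  refine word_mem ?_
  obtain ⟨h1, h2⟩ := hw
  cases l with
  | nil => exact absurd rfl h1
  | cons c l =>
    refine ⟨h1, ?_⟩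
    simp only [Word.lastExp, List.getLastD_cons] at h2 ⊢
    exact h2

theorem mulY_endsY {x : PolyDJY} (hx : x ∈ Submodule.span ℚ (word '' endsY)) :
    mulY x ∈ Submodule.span ℚ (word '' endsY) := by
  refine span_map mulY (fun w hw => ?_) hx
  rw [mulY_word]
  refine word_mem ⟨by simp, ?_⟩
  simpa only [Word.lastExp, List.getLastD_cons] using hw.2

theorem shWord_gWord_endsY (b : ℕ) (l : List ℤ) : ∀ (k : ℤ), Word.EndsInY (k, l) →
    shWord (gWord b) (k, l) ∈ Submodule.span ℚ (word '' endsY) := by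
  induction b generalizing l with
  | zero =>
    intro k h
    rw [shWord_gWord_zero]
    exact mulY_endsY (word_mem h)
  | succ b ihb =>
    induction l with
    | nil => intro k h; exact absurd rfl h.1
    | cons a l ihl =>
      intro k h
      by_cases hk : k = 0
      · subst hk
        rw [shWord_gWord_y]
        have h2 : Word.lastExp (a, l) = 0 := by
          have := h.2
          simpa only [Word.lastExp, List.getLastD_cons] using this
        cases l with
        | nil =>
          have : a = 0 := h2
          subst this
          rw [← sh_word, sh_gWord_one]
          exact mulY_endsY (word_mem (gWord_endsInY _))
        | cons c l => exact mulY_endsY (ihl a ⟨by simp, h2⟩)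
      · have hneg : (-((b + 1 : ℕ) : ℤ)) < 0 := by push_cast; omega
        have e := shWord_d (-((b + 1 : ℕ) : ℤ)) [0] hneg k (a :: l) hk
        have e2 : ((-((b + 1 : ℕ) : ℤ) + 1, [0]) : Word) = gWord b := by
          simp only [gWord]; congr 1; push_cast; ring
        rw [e2] at e
        rw [gWord, e]
        have hshift : ∀ k', Word.EndsInY (k', a :: l) := fun k' => ⟨by simp, by
          have := h.2
          simpa only [Word.lastExp, List.getLastD_cons] using this⟩
        exact Submodule.sub_mem _ (jPow_endsY _ (ihb _ _ h)) (ihb _ _ (hshift _))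

theorem sh_gWord_endsY (b : ℕ) {x : PolyDJY} (hx : x ∈ Submodule.span ℚ (word '' endsY)) :
    sh (word (gWord b)) x ∈ Submodule.span ℚ (word '' endsY) := by
  refine span_map _ (fun w hw => ?_) hx
  rw [sh_word]
  exact shWord_gWord_endsY b w.2 w.1 hw

/-- Combinations of words ending in `y` all of whose left multiples by `d^k` lie in `𝓛`. -/
def stableL : Submodule ℚ PolyDJY where
  carrier := {x | x ∈ Submodule.span ℚ (word '' endsY) ∧ ∀ k : ℕ, jPow (-(k : ℤ)) x ∈ idealL}
  zero_mem' := ⟨Submodule.zero_mem _, fun k => by rw [map_zero]; exact Submodule.zero_mem _⟩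
  add_mem' := fun ha hb => ⟨Submodule.add_mem _ ha.1 hb.1, fun k => by
    rw [map_add]; exact Submodule.add_mem _ (ha.2 k) (hb.2 k)⟩
  smul_mem' := fun c x hx => ⟨Submodule.smul_mem _ _ hx.1, fun k => by
    rw [map_smul]; exact Submodule.smul_mem _ _ (hx.2 k)⟩

theorem stableL_le {x : PolyDJY} (hx : x ∈ stableL) : x ∈ idealL := by
  have := hx.2 0
  rwa [Nat.cast_zero, neg_zero, jPow_zero] at this

theorem stableL_mulD {x : PolyDJY} (hx : x ∈ stableL) : mulD x ∈ stableL := by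
  refine ⟨jPow_endsY _ hx.1, fun k => ?_⟩
  rw [mulD, ← jPow_add]
  have := hx.2 (k + 1)
  convert this using 2
  push_cast
  congr 1
  ring

/-- The defect of the Leibniz rule. -/
def defect (b : ℕ) : PolyDJY →ₗ[ℚ] PolyDJY :=
  mulD ∘ₗ sh (word (gWord b)) - sh (word (gWord (b + 1))) - sh (word (gWord b)) ∘ₗ mulD

theorem defect_apply (b : ℕ) (x : PolyDJY) : defect b x = mulD (sh (word (gWord b)) x)
    - sh (word (gWord (b + 1))) x - sh (word (gWord b)) (mulD x) := rfl

theorem defect_jPow (b : ℕ) (k : ℤ) {x : PolyDJY}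
    (hx : x ∈ Submodule.span ℚ (word '' endsY)) : jPow k (defect b x) ∈ idealL := by
  refine span_induct (idealL.comap (jPow k ∘ₗ defect b)) (fun w hw => ?_) hx
  refine Submodule.mem_sInf.2 fun I hI => hI.2 ?_
  refine ⟨k, gWord b, w, gWord_endsInY b, hw, ?_⟩
  simp only [LinearMap.comp_apply, defect_apply, mulD_gWord]

theorem defect_mem (b : ℕ) {x : PolyDJY} (hx : x ∈ Submodule.span ℚ (word '' endsY)) :
    defect b x ∈ stableL := by
  refine ⟨?_, fun k => defect_jPow b _ hx⟩
  rw [defect_apply]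
  exact Submodule.sub_mem _ (Submodule.sub_mem _ (jPow_endsY _ (sh_gWord_endsY _ hx))
    (sh_gWord_endsY _ hx)) (sh_gWord_endsY _ (jPow_endsY _ hx))

theorem stableL_sh (b : ℕ) {x : PolyDJY} (hx : x ∈ stableL) :
    sh (word (gWord b)) x ∈ stableL := by
  refine ⟨sh_gWord_endsY b hx.1, fun k => ?_⟩
  induction k generalizing b x with
  | zero =>
    rw [Nat.cast_zero, neg_zero, jPow_zero]
    exact sh_mem_idealL (stableL_le hx) _
  | succ k ih =>
    have e : (-((k + 1 : ℕ) : ℤ)) = -(k : ℤ) + -1 := by push_cast; ring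
    rw [e, jPow_add]
    change jPow _ (mulD _) ∈ _
    have e2 : mulD (sh (word (gWord b)) x) = defect b x + sh (word (gWord (b + 1))) x
        + sh (word (gWord b)) (mulD x) := by rw [defect_apply]; abel
    rw [e2, map_add, map_add]
    exact Submodule.add_mem _ (Submodule.add_mem _ (defect_jPow b _ hx.1) (ih _ hx))
      (ih _ (stableL_mulD hx))

theorem stableL_mulY {x : PolyDJY} (hx : x ∈ stableL) : mulY x ∈ stableL := by
  rw [← sh_gWord_zero]; exact stableL_sh 0 hx

/-- The largest left ideal of `ℚ⟨d, y⟩` inside `𝓣₋ + 𝓛₋`. -/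
def coreIdeal : Ideal PolyDY where
  carrier := {x | ∀ p : PolyDY, p * x ∈ idealTL}
  zero_mem' := fun p => by rw [mul_zero]; exact Submodule.zero_mem _
  add_mem' := fun ha hb p => by rw [mul_add]; exact Submodule.add_mem _ (ha p) (hb p)
  smul_mem' := fun c x hx p => by rw [smul_eq_mul, ← mul_assoc]; exact hx _

theorem mem_coreIdeal {x : PolyDY} : x ∈ coreIdeal ↔ ∀ p : PolyDY, p * x ∈ idealTL := Iff.rfl

theorem coreIdeal_le {x : PolyDY} (hx : x ∈ coreIdeal) : x ∈ idealTL := by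
  simpa using hx 1

theorem mem_coreIdeal_of_stable {x : PolyDY} (hx : inclusion x ∈ stableL) : x ∈ coreIdeal := by
  intro p
  refine Submodule.mem_sup_right ?_
  rw [Submodule.mem_comap, inclusion_mul]
  exact stableL_le (letterAction_mem mulD mulY stableL (fun b => stableL_mulD)
    (fun b => stableL_mulY) p _ hx)

theorem mul_dd_mem (p : PolyDY) : p * dd ∈ coreIdeal := by
  intro q
  rw [← mul_assoc]
  refine Submodule.mem_sup_left ?_
  rw [Submodule.mem_comap, inclusion_mul]
  have h := letterAction_mem mulD mulY
    (Submodule.span ℚ (word '' {w : Word | w.lastExp < 0})) (fun b hb => ?_) (fun b hb => ?_)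
    (q * p) (inclusion dd) ?_
  · refine span_map LinearMap.id (fun w hw => word_mem ?_) h
    exact ne_of_lt hw
  · refine span_map mulD (fun w hw => ?_) hb
    rw [mulD_word]
    refine word_mem ?_
    obtain ⟨a, l⟩ := w
    cases l with
    | nil =>
      change a < 0 at hw
      change -1 + a < 0
      omega
    | cons c l =>
      change Word.lastExp _ < 0 at hw
      change Word.lastExp _ < 0
      simpa only [Word.lastExp, List.getLastD_cons] using hw
  · refine span_map mulY (fun w hw => ?_) hb
    rw [mulY_word]
    refine word_mem ?_
    change Word.lastExp _ < 0 at hw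
    change Word.lastExp _ < 0
    simpa only [Word.lastExp, List.getLastD_cons] using hw
  · rw [inclusion_apply, letterAction_dd, mulD_word]
    exact word_mem (by change (-1 + 0 : ℤ) < 0; norm_num)

/-- The iterated commutators `[d, [d, ⋯ [d, y]]]`. -/
def adY : ℕ → PolyDY
  | 0 => yy
  | b + 1 => dd * adY b - adY b * dd

theorem inclusion_yy_mul (w : PolyDY) : inclusion (yy * w) = mulY (inclusion w) := by
  rw [inclusion_mul, letterAction_yy]

theorem inclusion_dd_mul (w : PolyDY) : inclusion (dd * w) = mulD (inclusion w) := by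
  rw [inclusion_mul, letterAction_dd]

theorem inclusion_one : inclusion 1 = word (0, []) := by simp [inclusion_apply]

theorem inclusion_yy : inclusion yy = word (gWord 0) := by
  rw [inclusion_apply, letterAction_yy, mulY_word]; rfl

theorem inclusion_mul_yy (p : PolyDY) :
    inclusion (p * yy) ∈ Submodule.span ℚ (word '' endsY) := by
  rw [inclusion_mul, inclusion_yy]
  exact letterAction_mem mulD mulY _ (fun b hb => jPow_endsY _ hb) (fun b hb => mulY_endsY hb)
    p _ (word_mem (gWord_endsInY 0))

theorem adY_sh (b : ℕ) (p : PolyDY) :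
    inclusion (adY b * (p * yy)) - sh (word (gWord b)) (inclusion (p * yy)) ∈ stableL := by
  induction b generalizing p with
  | zero =>
    rw [adY, inclusion_yy_mul, sh_gWord_zero, sub_self]; exact Submodule.zero_mem _
  | succ b ih =>
    have h1 := stableL_mulD (ih p)
    have h2 := ih (dd * p)
    have h3 := defect_mem b (inclusion_mul_yy p)
    have e : inclusion (adY (b + 1) * (p * yy)) = mulD (inclusion (adY b * (p * yy)))
        - inclusion (adY b * (dd * p * yy)) := by
      rw [adY, sub_mul, map_sub, mul_assoc, inclusion_dd_mul, mul_assoc (adY b), mul_assoc dd]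
    have e2 : inclusion (dd * p * yy) = mulD (inclusion (p * yy)) := by
      rw [mul_assoc, inclusion_dd_mul]
    rw [e2] at h2
    rw [defect_apply] at h3
    rw [map_sub] at h1
    rw [e]
    convert Submodule.add_mem _ (Submodule.sub_mem _ h1 h2) h3 using 1
    abel

theorem adY_sub_mem (b : ℕ) : ∃ p : PolyDY, adY b - dd ^ b * yy = p * dd := by
  induction b with
  | zero => exact ⟨0, by simp [adY]⟩
  | succ b ih =>
    obtain ⟨p, hp⟩ := ih
    refine ⟨dd * p - adY b, ?_⟩
    rw [adY, sub_mul, mul_assoc dd p, ← hp, pow_succ']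
    noncomm_ring

theorem inclusion_gWord (b : ℕ) : inclusion (dd ^ b * yy) = word (gWord b) := by
  induction b with
  | zero => rw [pow_zero, one_mul, inclusion_yy]
  | succ b ih => rw [pow_succ', mul_assoc, inclusion_dd_mul, ih, mulD_gWord]

theorem exists_decomp (p : PolyDY) :
    ∃ (c : ℚ) (u v : PolyDY), p = algebraMap ℚ PolyDY c + u * yy + v * dd := by
  induction p using PolyDY.induct with
  | h1 c => exact ⟨c, 0, 0, by simp⟩
  | hd => exact ⟨0, 0, 1, by simp⟩
  | hy => exact ⟨0, 1, 0, by simp⟩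
  | hm a b h1 h2 =>
    obtain ⟨c, u, v, rfl⟩ := h1
    obtain ⟨c', u', v', rfl⟩ := h2
    refine ⟨c * c', algebraMap ℚ PolyDY c' * u +
        (algebraMap ℚ PolyDY c + u * yy + v * dd) * u',
      algebraMap ℚ PolyDY c' * v + (algebraMap ℚ PolyDY c + u * yy + v * dd) * v', ?_⟩
    rw [mul_add, mul_add, ← Algebra.commutes c' (algebraMap ℚ PolyDY c + u * yy + v * dd), map_mul,
      Algebra.commutes c (algebraMap ℚ PolyDY c')]
    noncomm_ring
  | ha a b h1 h2 =>
    obtain ⟨c, u, v, rfl⟩ := h1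
    obtain ⟨c', u', v', rfl⟩ := h2
    exact ⟨c + c', u + u', v + v', by rw [map_add, add_mul, add_mul]; abel⟩

theorem commutator_mem (b : ℕ) (w : PolyDY) :
    (yy * adY b - adY b * yy) * w ∈ coreIdeal := by
  obtain ⟨c, u, v, rfl⟩ := exists_decomp w
  rw [mul_add, mul_add]
  refine coreIdeal.add_mem (coreIdeal.add_mem ?_ ?_) ?_
  · rw [← Algebra.commutes]
    refine coreIdeal.mul_mem_left _ ?_
    obtain ⟨p, hp⟩ := adY_sub_mem b
    have h1 : yy * adY b - yy * (dd ^ b * yy) ∈ coreIdeal := by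
      rw [← mul_sub, hp, ← mul_assoc]; exact mul_dd_mem _
    have h2 : adY b * yy - yy * (dd ^ b * yy) ∈ coreIdeal := by
      apply mem_coreIdeal_of_stable
      have := adY_sh b 1
      rw [one_mul] at this
      convert this using 1
      rw [map_sub, inclusion_yy_mul, inclusion_gWord, inclusion_yy]
      have : (word (gWord 0)) = mulY (word (0, [])) := by rw [mulY_word]; rfl
      rw [this, sh_gWord_mulY, sh_gWord_one]
    have := coreIdeal.sub_mem h1 h2
    rwa [sub_sub_sub_cancel_right] at this
  · apply mem_coreIdeal_of_stable
    have h1 := stableL_mulY (adY_sh b u)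
    have h2 := adY_sh b (yy * u)
    rw [mul_assoc yy, inclusion_yy_mul, sh_gWord_mulY] at h2
    rw [map_sub] at h1
    convert Submodule.sub_mem _ h1 h2 using 1
    rw [sub_mul, map_sub, mul_assoc, inclusion_yy_mul, mul_assoc (adY b) yy]
    abel
  · rw [← mul_assoc]; exact mul_dd_mem _

end closure

section kernel

theorem commute_all {E : Type*} [Ring E] (D : E) (M : ℕ → E)
    (hM : ∀ n, M (n + 1) = D * M n - M n * D) (h0 : ∀ b, M 0 * M b = M b * M 0) :
    ∀ a b, M a * M b = M b * M a := by
  intro a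
  induction a with
  | zero => exact h0
  | succ a ih =>
    intro b
    have h1 := ih b
    have h2 := ih (b + 1)
    rw [hM b] at h2
    rw [hM a]
    have e : (D * M a - M a * D) * M b - M b * (D * M a - M a * D) =
        D * (M a * M b - M b * M a) - (M a * M b - M b * M a) * D
          - (M a * (D * M b - M b * D) - (D * M b - M b * D) * M a) := by noncomm_ring
    rw [h1, h2, sub_self, sub_self, mul_zero, zero_mul, sub_zero, sub_zero] at e
    exact sub_eq_zero.1 e

theorem exists_algHom {E : Type*} [Ring E] [Algebra ℚ E] (M : ℕ → E)
    (hM : ∀ a b, M a * M b = M b * M a) :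
    ∃ Θ : DiffPoly →ₐ[ℚ] E, ∀ n, Θ (MvPolynomial.X n) = M n := by
  have hc : IsMulCommutative (Algebra.adjoin ℚ (Set.range M)) :=
    Algebra.isMulCommutative_adjoin ℚ (by
      rintro _ ⟨a, rfl⟩ _ ⟨b, rfl⟩
      exact hM a b)
  let _ : CommRing (Algebra.adjoin ℚ (Set.range M)) :=
    { (inferInstance : Ring (Algebra.adjoin ℚ (Set.range M))) with
      mul_comm := hc.is_comm.comm }
  let M' : ℕ → Algebra.adjoin ℚ (Set.range M) :=
    fun n => ⟨M n, Algebra.subset_adjoin ⟨n, rfl⟩⟩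
  refine ⟨(Algebra.adjoin ℚ (Set.range M)).val.comp (MvPolynomial.aeval M'), fun n => ?_⟩
  simp [M']

theorem mem_idealTL_of_toDiffPoly {p : PolyDY} (hp : toDiffPoly p = 0) : p ∈ idealTL := by
  apply coreIdeal_le
  let Q := PolyDY ⧸ coreIdeal
  let lm : PolyDY →ₐ[ℚ] Module.End ℚ Q := Algebra.lsmul ℚ ℚ Q
  let one : Q := Submodule.Quotient.mk 1
  have hmk : ∀ a x : PolyDY, lm a (Submodule.Quotient.mk x) = Submodule.Quotient.mk (a * x) :=
    fun a x => rfl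
  have hM : ∀ n, lm (adY (n + 1)) = lm dd * lm (adY n) - lm (adY n) * lm dd := by
    intro n
    rw [← map_mul, ← map_mul, ← map_sub]
    rfl
  have h0 : ∀ b, lm (adY 0) * lm (adY b) = lm (adY b) * lm (adY 0) := by
    intro b
    rw [← sub_eq_zero, ← map_mul, ← map_mul, ← map_sub]
    refine LinearMap.ext fun x => ?_
    obtain ⟨x, rfl⟩ := Submodule.Quotient.mk_surjective coreIdeal x
    rw [hmk, LinearMap.zero_apply, Submodule.Quotient.mk_eq_zero]
    exact commutator_mem b x
  obtain ⟨Θ, hΘ⟩ := exists_algHom (fun n => lm (adY n))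
    (commute_all (lm dd) (fun n => lm (adY n)) hM h0)
  have hcomm : ∀ q : DiffPoly, lm dd * Θ q = Θ (dX q) + Θ q * lm dd := by
    intro q
    induction q using MvPolynomial.induction_on with
    | C c =>
      rw [← MvPolynomial.algebraMap_eq, Derivation.map_algebraMap, map_zero, zero_add,
        AlgHom.commutes, Algebra.commutes]
    | add p q hp hq => simp only [map_add, mul_add, add_mul, hp, hq]; abel
    | mul_X p n ih =>
      have hX : lm dd * lm (adY n) = lm (adY (n + 1)) + lm (adY n) * lm dd := by
        rw [adY, map_sub, map_mul, map_mul]; abel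
      rw [Derivation.leibniz, dX_X, map_mul, hΘ, ← mul_assoc, ih, smul_eq_mul, smul_eq_mul,
        map_add, mul_comm (MvPolynomial.X n), map_mul, map_mul, hΘ, hΘ, add_mul, mul_assoc,
        hX]
      noncomm_ring
  have key : ∀ p : PolyDY, ∀ q : DiffPoly, lm p (Θ q one) =
      Θ (letterAction dX.toLinearMap (LinearMap.mulLeft ℚ (MvPolynomial.X 0)) p q) one := by
    intro p
    induction p using PolyDY.induct with
    | h1 c => intro q; simp [Module.algebraMap_end_apply, AlgHom.commutes]
    | hd =>
      intro q
      rw [letterAction_dd]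
      have h := LinearMap.congr_fun (hcomm q) one
      have h0 : lm dd one = 0 := by
        rw [hmk, Submodule.Quotient.mk_eq_zero, mul_one]
        simpa using mul_dd_mem 1
      simp only [Module.End.mul_apply, LinearMap.add_apply, h0, map_zero, add_zero] at h
      exact h
    | hy =>
      intro q
      rw [letterAction_yy, LinearMap.mulLeft_apply, map_mul, hΘ]; rfl
    | hm a b h1 h2 => intro q; rw [map_mul, map_mul, Module.End.mul_apply, h2, h1]; rfl
    | ha a b h1 h2 =>
      intro q
      rw [map_add, map_add, LinearMap.add_apply, h1, h2, LinearMap.add_apply, map_add]; rfl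
  have h := key p 1
  rw [← toDiffPoly_apply, hp, map_zero, map_one, Module.End.one_apply, LinearMap.zero_apply,
    hmk, mul_one, Submodule.Quotient.mk_eq_zero] at h
  exact h

theorem idealTL_eq_ker : idealTL = LinearMap.ker toDiffPoly := by
  ext p
  exact ⟨fun h => toDiffPoly_idealTL h, fun h => mem_idealTL_of_toDiffPoly h⟩

end kernel

/-! ### The coalgebra `(𝓗₋, Δ₀)` -/
section coalgebra
open scoped TensorProduct

/-- The coproduct of `ℚ⟨d, y⟩`: the algebra homomorphism (for concatenation) for which `d` and
`y` are primitive.  On a word it is the sum of `w_S ⊗ w_{Sᶜ}` over all subsets `S` of the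
positions; modulo words ending in `d` this is the usual explicit formula for `Δ₀`. -/
def coproductDY : PolyDY →ₐ[ℚ] PolyDY ⊗[ℚ] PolyDY :=
  FreeAlgebra.lift ℚ fun a => FreeAlgebra.ι ℚ a ⊗ₜ[ℚ] 1 + 1 ⊗ₜ[ℚ] FreeAlgebra.ι ℚ a

/-- The counit of `ℚ⟨d, y⟩`. -/
def counitDY : PolyDY →ₐ[ℚ] ℚ := FreeAlgebra.lift ℚ fun _ => 0

theorem coproductDY_dd : coproductDY dd = dd ⊗ₜ 1 + 1 ⊗ₜ dd := by simp [coproductDY, dd]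
theorem coproductDY_yy : coproductDY yy = yy ⊗ₜ 1 + 1 ⊗ₜ yy := by simp [coproductDY, yy]

/-- The coproduct of `DiffPoly` with primitive variables. -/
def coproductX : DiffPoly →ₐ[ℚ] DiffPoly ⊗[ℚ] DiffPoly :=
  MvPolynomial.aeval fun n => MvPolynomial.X n ⊗ₜ[ℚ] 1 + 1 ⊗ₜ[ℚ] MvPolynomial.X n

theorem coproductX_dX (q : DiffPoly) :
    coproductX (dX q) = (TensorProduct.map dX.toLinearMap (LinearMap.id (R := ℚ)) +
      TensorProduct.map (LinearMap.id (R := ℚ)) dX.toLinearMap :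
      DiffPoly ⊗[ℚ] DiffPoly →ₗ[ℚ] DiffPoly ⊗[ℚ] DiffPoly) (coproductX q) := by
  let T : DiffPoly ⊗[ℚ] DiffPoly →ₗ[ℚ] DiffPoly ⊗[ℚ] DiffPoly :=
    TensorProduct.map dX.toLinearMap LinearMap.id + TensorProduct.map LinearMap.id dX.toLinearMap
  have hT : ∀ a b, T (a ⊗ₜ b) = dX a ⊗ₜ b + a ⊗ₜ dX b := fun a b => rfl
  have hmul : ∀ x y, T (x * y) = T x * y + x * T y := by
    intro x y
    induction x using TensorProduct.induction_on with
    | zero => simp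
    | add x x' h h' => rw [add_mul, map_add, h, h', map_add, add_mul, add_mul]; abel
    | tmul a b =>
      induction y using TensorProduct.induction_on with
      | zero => simp
      | add y y' h h' => rw [mul_add, map_add, h, h', map_add, mul_add, mul_add]; abel
      | tmul c d =>
        simp only [Algebra.TensorProduct.tmul_mul_tmul, hT, Derivation.leibniz, smul_eq_mul,
          add_mul, mul_add, TensorProduct.add_tmul, TensorProduct.tmul_add]
        rw [mul_comm c (dX a), mul_comm d (dX b)]
        abel
  change coproductX (dX q) = T (coproductX q)
  induction q using MvPolynomial.induction_on with
  | C c =>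
    rw [← MvPolynomial.algebraMap_eq, Derivation.map_algebraMap, map_zero, AlgHom.commutes,
      Algebra.algebraMap_eq_smul_one, map_smul, Algebra.TensorProduct.one_def, hT]
    simp
  | add p q hp hq => simp only [map_add, hp, hq]
  | mul_X p n ih =>
    have hX : ∀ n, coproductX (MvPolynomial.X n) =
      MvPolynomial.X n ⊗ₜ[ℚ] 1 + 1 ⊗ₜ[ℚ] MvPolynomial.X n := fun n => by simp [coproductX]
    have hTX : T (coproductX (MvPolynomial.X n)) = coproductX (MvPolynomial.X (n + 1)) := by
      rw [hX, hX, map_add, hT, hT, dX_X, Derivation.map_one_eq_zero]; simp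
    rw [Derivation.leibniz, dX_X, map_mul, hmul, ← ih, hTX, map_add, smul_eq_mul, smul_eq_mul,
      map_mul, map_mul]
    ring

theorem toDiffPoly_coproduct (p : PolyDY) :
    TensorProduct.map toDiffPoly toDiffPoly (coproductDY p) = coproductX (toDiffPoly p) := by
  let act := letterAction dX.toLinearMap (LinearMap.mulLeft ℚ (MvPolynomial.X 0 : DiffPoly))
  let act2 : PolyDY ⊗[ℚ] PolyDY →ₗ[ℚ] Module.End ℚ (DiffPoly ⊗[ℚ] DiffPoly) :=
    TensorProduct.homTensorHomMap (RingHom.id ℚ) DiffPoly DiffPoly DiffPoly DiffPoly ∘ₗ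
      TensorProduct.map act.toLinearMap act.toLinearMap
  have hact2 : ∀ a b, act2 (a ⊗ₜ b) = TensorProduct.map (act a) (act b) := fun a b => rfl
  have hmul : ∀ x y, act2 (x * y) = act2 x * act2 y := by
    intro x y
    induction x using TensorProduct.induction_on with
    | zero => simp
    | add x x' h h' => rw [add_mul, map_add, h, h', map_add, add_mul]
    | tmul a b =>
      induction y using TensorProduct.induction_on with
      | zero => simp
      | add y y' h h' => rw [mul_add, map_add, h, h', map_add, mul_add]
      | tmul c d =>
        rw [Algebra.TensorProduct.tmul_mul_tmul, hact2, hact2, hact2, map_mul, map_mul]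
        exact TensorProduct.map_mul _ _ _ _
  have key : ∀ p : PolyDY, ∀ q : DiffPoly,
      act2 (coproductDY p) (coproductX q) = coproductX (act p q) := by
    intro p
    induction p using PolyDY.induct with
    | h1 c =>
      intro q
      rw [AlgHom.commutes, AlgHom.commutes, Algebra.algebraMap_eq_smul_one,
        Algebra.TensorProduct.one_def, map_smul, hact2, map_one]
      simp [Module.algebraMap_end_apply]
    | hd =>
      intro q
      have : act dd = dX.toLinearMap := letterAction_dd _ _
      rw [coproductDY_dd, map_add, hact2, hact2, map_one, this]
      exact (coproductX_dX q).symm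
    | hy =>
      intro q
      have : act yy = LinearMap.mulLeft ℚ (MvPolynomial.X 0) := letterAction_yy _ _
      rw [coproductDY_yy, map_add, hact2, hact2, map_one, this, LinearMap.mulLeft_apply, map_mul]
      have hX : coproductX (MvPolynomial.X 0) =
        MvPolynomial.X 0 ⊗ₜ[ℚ] 1 + 1 ⊗ₜ[ℚ] MvPolynomial.X 0 := by simp [coproductX]
      rw [hX, LinearMap.add_apply, add_mul]
      congr 1
      · generalize coproductX q = z
        induction z using TensorProduct.induction_on with
        | zero => simp
        | add x x' h h' => rw [map_add, h, h', mul_add]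
        | tmul a b => simp
      · generalize coproductX q = z
        induction z using TensorProduct.induction_on with
        | zero => simp
        | add x x' h h' => rw [map_add, h, h', mul_add]
        | tmul a b => simp
    | hm a b h1 h2 =>
      intro q
      rw [map_mul, hmul, Module.End.mul_apply, h2, h1, map_mul]; rfl
    | ha a b h1 h2 =>
      intro q
      rw [map_add, map_add, LinearMap.add_apply, h1, h2, map_add, LinearMap.add_apply, map_add]
  have h := key p 1
  rw [map_one] at h
  change _ = coproductX (act p 1)
  rw [← h]
  generalize coproductDY p = z
  induction z using TensorProduct.induction_on with
  | zero => simp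
  | add x x' h h' => rw [map_add, h, h', map_add, LinearMap.add_apply]
  | tmul a b => rw [hact2, Algebra.TensorProduct.one_def]; rfl

theorem counitDY_eq (p : PolyDY) : counitDY p = MvPolynomial.constantCoeff (toDiffPoly p) := by
  have hd : ∀ q : DiffPoly, MvPolynomial.constantCoeff (dX q) = 0 := by
    intro q
    induction q using MvPolynomial.induction_on with
    | C c => rw [← MvPolynomial.algebraMap_eq, Derivation.map_algebraMap, map_zero]
    | add p q hp hq => simp [hp, hq]
    | mul_X p n ih => rw [Derivation.leibniz, dX_X]; simp
  have key : ∀ p : PolyDY, ∀ q : DiffPoly,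
      MvPolynomial.constantCoeff (letterAction dX.toLinearMap
        (LinearMap.mulLeft ℚ (MvPolynomial.X 0)) p q) =
      counitDY p * MvPolynomial.constantCoeff q := by
    intro p
    induction p using PolyDY.induct with
    | h1 c => intro q; simp [Module.algebraMap_end_apply]
    | hd =>
      intro q
      rw [letterAction_dd]
      have : counitDY dd = 0 := by simp [counitDY, dd]
      rw [this, zero_mul]; exact hd q
    | hy =>
      intro q
      have : counitDY yy = 0 := by simp [counitDY, yy]
      rw [letterAction_yy, this]; simp
    | hm a b h1 h2 => intro q; rw [map_mul, Module.End.mul_apply, h1, h2, map_mul, mul_assoc]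
    | ha a b h1 h2 =>
      intro q; rw [map_add, LinearMap.add_apply, map_add, h1, h2, map_add, add_mul]
  have := key p 1
  have h1 : MvPolynomial.constantCoeff (1 : DiffPoly) = 1 := map_one _
  rw [h1, mul_one] at this
  rw [← this]; rfl

theorem coproduct_wellDefined :
    idealTL ≤ LinearMap.ker (TensorProduct.map idealTL.mkQ idealTL.mkQ ∘ₗ
      coproductDY.toLinearMap) := by
  intro p hp
  have hinj : Function.Injective (idealTL.liftQ toDiffPoly idealTL_eq_ker.le) := by
    rw [← LinearMap.ker_eq_bot]
    exact Submodule.ker_liftQ_eq_bot _ _ _ idealTL_eq_ker.ge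
  obtain ⟨g, hg⟩ := LinearMap.exists_leftInverse_of_injective _ (LinearMap.ker_eq_bot.2 hinj)
  have h2 : idealTL.mkQ = g ∘ₗ toDiffPoly := by
    ext x
    have := LinearMap.congr_fun hg (idealTL.mkQ x)
    simpa using this.symm
  rw [LinearMap.mem_ker, h2, TensorProduct.map_comp]
  simp only [LinearMap.comp_apply, AlgHom.toLinearMap_apply]
  rw [toDiffPoly_coproduct, toDiffPoly_idealTL hp, map_zero, map_zero]

theorem counit_wellDefined : idealTL ≤ LinearMap.ker counitDY.toLinearMap := by
  intro p hp
  rw [LinearMap.mem_ker, AlgHom.toLinearMap_apply, counitDY_eq, toDiffPoly_idealTL hp, map_zero]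

theorem coproductDY_coassoc (p : PolyDY) :
    TensorProduct.assoc ℚ PolyDY PolyDY PolyDY
      (coproductDY.toLinearMap.rTensor PolyDY (coproductDY p)) =
    coproductDY.toLinearMap.lTensor PolyDY (coproductDY p) := by
  have : ((Algebra.TensorProduct.assoc ℚ ℚ ℚ PolyDY PolyDY PolyDY).toAlgHom.comp
      (Algebra.TensorProduct.map coproductDY (AlgHom.id ℚ PolyDY))).comp coproductDY =
      (Algebra.TensorProduct.map (AlgHom.id ℚ PolyDY) coproductDY).comp coproductDY := by
    apply FreeAlgebra.hom_ext
    funext a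
    simp [coproductDY, TensorProduct.add_tmul, TensorProduct.tmul_add,
      Algebra.TensorProduct.one_def, add_assoc]
  exact AlgHom.congr_fun this p

theorem counitDY_rTensor (p : PolyDY) :
    counitDY.toLinearMap.rTensor PolyDY (coproductDY p) = 1 ⊗ₜ p := by
  have : (Algebra.TensorProduct.map counitDY (AlgHom.id ℚ PolyDY)).comp coproductDY =
      Algebra.TensorProduct.includeRight := by
    apply FreeAlgebra.hom_ext
    funext a
    simp [coproductDY, counitDY]
  exact AlgHom.congr_fun this p

theorem counitDY_lTensor (p : PolyDY) :
    counitDY.toLinearMap.lTensor PolyDY (coproductDY p) = p ⊗ₜ 1 := by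
  have : (Algebra.TensorProduct.map (AlgHom.id ℚ PolyDY) counitDY).comp coproductDY =
      Algebra.TensorProduct.includeLeft := by
    apply FreeAlgebra.hom_ext
    funext a
    simp [coproductDY, counitDY]
  exact AlgHom.congr_fun this p

/-- The coproduct `Δ₀` and the counit of `𝓗₋`, induced from `ℚ⟨d, y⟩`. -/
instance : CoalgebraStruct ℚ HMinus where
  comul := idealTL.liftQ _ coproduct_wellDefined
  counit := idealTL.liftQ _ counit_wellDefined

theorem comul_mk : (Coalgebra.comul (R := ℚ) (A := HMinus)) ∘ₗ idealTL.mkQ =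
    TensorProduct.map idealTL.mkQ idealTL.mkQ ∘ₗ coproductDY.toLinearMap :=
  Submodule.liftQ_mkQ _ _ _

theorem counit_mk : (Coalgebra.counit (R := ℚ) (A := HMinus)) ∘ₗ idealTL.mkQ =
    counitDY.toLinearMap := Submodule.liftQ_mkQ _ _ _

theorem comul_mk_apply (p : PolyDY) : Coalgebra.comul (R := ℚ) (idealTL.mkQ p) =
    TensorProduct.map idealTL.mkQ idealTL.mkQ (coproductDY p) := rfl

theorem counit_mk_apply (p : PolyDY) : Coalgebra.counit (R := ℚ) (idealTL.mkQ p) =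
    counitDY p := rfl

instance : Coalgebra ℚ HMinus where
  coassoc := by
    refine LinearMap.ext fun x => ?_
    obtain ⟨p, rfl⟩ := idealTL.mkQ_surjective x
    have hr : ∀ z : PolyDY ⊗[ℚ] PolyDY, (Coalgebra.comul (R := ℚ) (A := HMinus)).rTensor HMinus
        (TensorProduct.map idealTL.mkQ idealTL.mkQ z) =
        TensorProduct.map (TensorProduct.map idealTL.mkQ idealTL.mkQ) idealTL.mkQ
          (coproductDY.toLinearMap.rTensor PolyDY z) := by
      intro z
      induction z using TensorProduct.induction_on with
      | zero => simp
      | add a b h h' => simp only [map_add, h, h']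
      | tmul a b => rfl
    have hl : ∀ z : PolyDY ⊗[ℚ] PolyDY, (Coalgebra.comul (R := ℚ) (A := HMinus)).lTensor HMinus
        (TensorProduct.map idealTL.mkQ idealTL.mkQ z) =
        TensorProduct.map idealTL.mkQ (TensorProduct.map idealTL.mkQ idealTL.mkQ)
          (coproductDY.toLinearMap.lTensor PolyDY z) := by
      intro z
      induction z using TensorProduct.induction_on with
      | zero => simp
      | add a b h h' => simp only [map_add, h, h']
      | tmul a b => rfl
    simp only [LinearMap.comp_apply, LinearEquiv.coe_coe]
    rw [comul_mk_apply, hr, hl, ← coproductDY_coassoc]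
    exact LinearMap.congr_fun
      (TensorProduct.map_map_comp_assoc_eq idealTL.mkQ idealTL.mkQ idealTL.mkQ).symm _
  rTensor_counit_comp_comul := by
    refine LinearMap.ext fun x => ?_
    obtain ⟨p, rfl⟩ := idealTL.mkQ_surjective x
    have hr : ∀ z : PolyDY ⊗[ℚ] PolyDY, (Coalgebra.counit (R := ℚ) (A := HMinus)).rTensor HMinus
        (TensorProduct.map idealTL.mkQ idealTL.mkQ z) =
        idealTL.mkQ.lTensor ℚ (counitDY.toLinearMap.rTensor PolyDY z) := by
      intro z
      induction z using TensorProduct.induction_on with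
      | zero => simp
      | add a b h h' => simp only [map_add, h, h']
      | tmul a b => rfl
    rw [LinearMap.comp_apply, comul_mk_apply, hr, counitDY_rTensor]
    rfl
  lTensor_counit_comp_comul := by
    refine LinearMap.ext fun x => ?_
    obtain ⟨p, rfl⟩ := idealTL.mkQ_surjective x
    have hl : ∀ z : PolyDY ⊗[ℚ] PolyDY, (Coalgebra.counit (R := ℚ) (A := HMinus)).lTensor HMinus
        (TensorProduct.map idealTL.mkQ idealTL.mkQ z) =
        idealTL.mkQ.rTensor ℚ (counitDY.toLinearMap.lTensor PolyDY z) := by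
      intro z
      induction z using TensorProduct.induction_on with
      | zero => simp
      | add a b h h' => simp only [map_add, h, h']
      | tmul a b => rfl
    rw [LinearMap.comp_apply, comul_mk_apply, hl, counitDY_lTensor]
    rfl

end coalgebra

/-! ### Characters with values in Laurent series -/

/-- The coefficientwise algebra structure, chosen among the available (equal) ones. -/
instance (priority := 2000) laurentAlgebra : Algebra ℚ (LaurentSeries ℚ) :=
  HahnSeries.instAlgebra

/-- The Leibniz rule for the formal derivative of Laurent series. -/
theorem laurent_leibniz (a b : LaurentSeries ℚ) :
    LaurentSeries.derivative ℚ (a * b) =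
      LaurentSeries.derivative ℚ a * b + a * LaurentSeries.derivative ℚ b := by
  let E : LaurentSeries ℚ → LaurentSeries ℚ := fun g =>
    ⟨fun n => n * g.coeff n, g.isPWO_support.mono fun n hn => by
      intro h
      exact hn (by simp [h])⟩
  have hE : ∀ g n, (E g).coeff n = n * g.coeff n := fun g n => rfl
  have hsupp : ∀ g, (E g).support ⊆ g.support := by
    intro g n hn h
    exact hn (by simp [hE, h])
  have hmul : E (a * b) = E a * b + a * E b := by
    ext n
    rw [hE, HahnSeries.coeff_add, HahnSeries.coeff_mul,
      HahnSeries.coeff_mul_left' a.isPWO_support (hsupp a),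
      HahnSeries.coeff_mul_right' b.isPWO_support (hsupp b), ← Finset.sum_add_distrib,
      Finset.mul_sum]
    refine Finset.sum_congr rfl fun x hx => ?_
    rw [hE, hE, ← (Finset.mem_antidiagonal.1 hx).2.2]
    push_cast
    ring
  have hder : ∀ g : LaurentSeries ℚ,
      LaurentSeries.derivative ℚ g = HahnSeries.single (-1 : ℤ) 1 * E g := by
    intro g
    ext n
    have : n = (n + 1) + (-1) := by ring
    conv_rhs => rw [this]
    rw [HahnSeries.coeff_single_mul_add, hE, LaurentSeries.derivative_apply,
      LaurentSeries.hasseDeriv_coeff]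
    simp
  rw [hder, hder, hder, hmul]
  ring

theorem iterated_wellDefined {B : Type*} [CommRing B] [Algebra ℚ B] (D : B →ₗ[ℚ] B) (f : B)
    (hD : ∀ a b, D (a * b) = D a * b + a * D b) : idealTL ≤ LinearMap.ker (iterated D f) := by
  intro p hp
  rw [LinearMap.mem_ker, iterated_eq_aeval D f hD, toDiffPoly_idealTL hp, map_zero]

/-- The map `ϕ` attached to a Laurent series `f`:
`ϕ(d^{k₁} y ⋯ d^{kᵣ} y) = ∂^{k₁}[f ∂^{k₂}[f ⋯ ∂^{kᵣ}[f] ⋯ ]]` and `ϕ(1) = 1`. -/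
def phi (f : LaurentSeries ℚ) : HMinus →ₗ[ℚ] LaurentSeries ℚ :=
  idealTL.liftQ (iterated (LaurentSeries.derivative ℚ) f)
    (iterated_wellDefined _ f laurent_leibniz)

/-- The class in `𝓗₋` of the word `d^{k₁} y ⋯ d^{kᵣ} y`, for the list `[k₁, …, kᵣ]`. -/
def dyWord (k : List ℕ) : HMinus := idealTL.mkQ (k.map fun n => dd ^ n * yy).prod

theorem phi_dyWord_nil (f : LaurentSeries ℚ) : phi f (dyWord []) = 1 := by
  change iterated (LaurentSeries.derivative ℚ) f 1 = 1
  simp [iterated_apply]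

theorem phi_dyWord_cons (f : LaurentSeries ℚ) (k : ℕ) (l : List ℕ) :
    phi f (dyWord (k :: l)) = (LaurentSeries.derivative ℚ)^[k] (f * phi f (dyWord l)) := by
  change iterated (LaurentSeries.derivative ℚ) f ((dd ^ k * yy) * _) = _
  rw [iterated_apply, map_mul, map_mul, map_pow, letterAction_dd, letterAction_yy]
  rw [Module.End.mul_apply, Module.End.mul_apply, Module.End.pow_apply]
  rfl

/-- `(φ₋, φ₊)` is the algebraic Birkhoff decomposition of `φ`, for linear maps from `𝓗₋` to the
Laurent series: `φ₋(1) = 1`, `φ₋` maps the augmentation ideal `ker ε` into `z⁻¹ℚ[z⁻¹]` (hence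
`𝓗₋` into `ℚ[z⁻¹]`), `φ₊` takes its values in `ℚ[[z]]`, and `φ = φ₋^{*-1} * φ₊`, where
`φ₋^{*-1}` is the inverse for the convolution product `α * β = m ∘ (α ⊗ β) ∘ Δ₀`. -/
structure IsBirkhoffDecomposition (φ φm φp : HMinus →ₗ[ℚ] LaurentSeries ℚ) : Prop where
  minus_one : φm (dyWord []) = 1
  minus_polar : ∀ x : HMinus, Coalgebra.counit (R := ℚ) x = 0 →
    ∀ n : ℤ, 0 ≤ n → (φm x).coeff n = 0
  plus_regular : ∀ (x : HMinus) (n : ℤ), n < 0 → (φp x).coeff n = 0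
  factorization : ∃ u : (WithConv (HMinus →ₗ[ℚ] LaurentSeries ℚ))ˣ,
    u.val = WithConv.toConv φm ∧ WithConv.toConv φ = u⁻¹.val * WithConv.toConv φp

/-- `F(k₁, …, kᵣ) = lim_{z → 0} φ₊(d^{kᵣ} y ⋯ d^{k₁} y)`: the constant coefficient of a series
without polar part.  Note the reversed order of the exponents. -/
def limitValue (φp : HMinus →ₗ[ℚ] LaurentSeries ℚ) {r : ℕ} (k : Fin r → ℕ) : ℚ :=
  (φp (dyWord (List.ofFn k).reverse)).coeff 0

/-- The exponential generating function
`∑ F(k₁, …, kᵣ) z₁^{k₁} ⋯ zᵣ^{kᵣ} / (k₁! ⋯ kᵣ!)`, given by its coefficients. -/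
def genFun (φp : HMinus →ₗ[ℚ] LaurentSeries ℚ) (r : ℕ) : MvPowerSeries (Fin r) ℚ :=
  fun k => limitValue φp k / ∏ i, (Nat.factorial (k i) : ℚ)

/-- The part `f_{≥0}` of a Laurent series with nonnegative exponents. -/
def regularPart (f : LaurentSeries ℚ) : PowerSeries ℚ := PowerSeries.mk fun n => f.coeff n

end

end ShuffleRenorm

namespace ShuffleRenorm

/-! ### Convolution of the characters attached to Laurent series. -/

section convolution
open scoped TensorProduct

/-! Modulo `idealTL`, the space `HMinus` embeds into the free differential polynomial ring on one
generator. There `phi f` is the substitution of the derivatives of `f` for the variables, and the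
coproduct makes all variables primitive. Since differentiation is additive, `f ↦ phi f` turns sums
into convolution products (`phi_convMul`). Splitting `f` as a polar part `f₋` plus `f_{≥0}`
therefore factors `phi f` as `phi f₋ * phi f_{≥0}`. The polar series and the power series are each
closed under products and differentiation, so this is a Birkhoff decomposition with `φ₋ = phi (-f₋)`
and `φ₊ = phi f_{≥0}` (`isBirkhoffDecomposition_phi`).

For uniqueness, the difference `δ` of two candidates for `φ₋` is polar everywhere, while `δ * φ` is
regular. On a word `w`, the product `(δ * φ)(w)` equals `δ(w)` up to values of `δ` on shorter words,
so induction on the length makes `δ(w)` both polar and regular, hence zero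
(`eq_zero_of_convMul_regular`).

It remains to compute constant terms. Write `g = f_{≥0}` and `s_i = z_i + ⋯ + z_r`. In `h(s_i)
g(s_i) g(s_{i+1}) ⋯ g(s_r)` only the first two factors involve `z_i`. Differentiating `n` times in
`z_i` and then putting `z_i = 0` thus gives `∂ⁿ(g h)(s_{i+1}) g(s_{i+1}) ⋯ g(s_r)`
(`coeff_tailProd_succ`). Starting from `h = 1` and removing all variables in turn produces the
nested derivatives that define `F`. -/

theorem phi_mkQ (f : LaurentSeries ℚ) (p : PolyDY) :
    phi f (idealTL.mkQ p) = iterated (LaurentSeries.derivative ℚ) f p := rfl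

/-- Passing to `DiffPoly` replaces a nested operator expression by an algebra homomorphism, which is
determined by its values on the variables. -/
theorem phi_eq_aeval (f : LaurentSeries ℚ) (p : PolyDY) : phi f (idealTL.mkQ p) =
    MvPolynomial.aeval (fun n => (LaurentSeries.derivative ℚ)^[n] f) (toDiffPoly p) := by
  rw [phi_mkQ, iterated_eq_aeval _ _ laurent_leibniz]

/-- Lifts convolution to representatives in the free algebra, where the coproduct is multiplicative
and can be computed on words. -/
theorem convMul_mkQ (α β : HMinus →ₗ[ℚ] LaurentSeries ℚ) (p : PolyDY) :
    (WithConv.toConv α * WithConv.toConv β).ofConv (idealTL.mkQ p) =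
      LinearMap.mul' ℚ (LaurentSeries ℚ)
        (TensorProduct.map (α ∘ₗ idealTL.mkQ) (β ∘ₗ idealTL.mkQ) (coproductDY p)) := by
  rw [LinearMap.convMul_def]
  change LinearMap.mul' ℚ (LaurentSeries ℚ)
    (TensorProduct.map α β (Coalgebra.comul (R := ℚ) (idealTL.mkQ p))) = _
  rw [comul_mk_apply, TensorProduct.map_comp, LinearMap.comp_apply]

/-- The additivity of `f ↦ phi f`: the values of characters add up on primitive elements. -/
theorem phi_convMul (a b : LaurentSeries ℚ) :
    WithConv.toConv (phi a) * WithConv.toConv (phi b) = WithConv.toConv (phi (a + b)) := by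
  refine WithConv.ofConv_injective (LinearMap.ext fun x => ?_)
  obtain ⟨p, rfl⟩ := idealTL.mkQ_surjective x
  let ev : LaurentSeries ℚ → DiffPoly →ₐ[ℚ] LaurentSeries ℚ :=
    fun f => MvPolynomial.aeval fun n => (LaurentSeries.derivative ℚ)^[n] f
  have hev : ∀ f, phi f ∘ₗ idealTL.mkQ = (ev f).toLinearMap ∘ₗ toDiffPoly :=
    fun f => LinearMap.ext fun p => phi_eq_aeval f p
  rw [convMul_mkQ, hev, hev, TensorProduct.map_comp, LinearMap.comp_apply, toDiffPoly_coproduct]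
  change _ = phi (a + b) (idealTL.mkQ p)
  rw [phi_eq_aeval]
  -- Two algebra homomorphisms out of a polynomial ring are compared on the variables: `X n` is
  -- primitive, and the `n`-th derivative of `a + b` is the sum of the `n`-th derivatives.
  have : (Algebra.TensorProduct.lift (ev a) (ev b) fun _ _ => Commute.all _ _).comp coproductX =
      ev (a + b) := by
    refine MvPolynomial.algHom_ext fun n => ?_
    simp [coproductX, ev, ← Module.End.pow_apply]
  rw [← show _ = MvPolynomial.aeval _ (toDiffPoly p) from AlgHom.congr_fun this (toDiffPoly p)]
  rw [AlgHom.comp_apply]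
  generalize coproductX (toDiffPoly p) = z
  induction z using TensorProduct.induction_on with
  | zero => simp
  | add x y hx hy => rw [map_add, map_add, map_add, hx, hy]
  | tmul x y => rfl

/-- Substituting zero for every variable leaves the constant term, which is the counit; the counit
followed by the structure map is the unit for convolution. -/
theorem phi_zero : WithConv.toConv (phi 0) = 1 := by
  refine WithConv.ofConv_injective (LinearMap.ext fun x => ?_)
  obtain ⟨p, rfl⟩ := idealTL.mkQ_surjective x
  change phi 0 (idealTL.mkQ p) = algebraMap ℚ (LaurentSeries ℚ) (counitDY p)
  rw [phi_eq_aeval, counitDY_eq]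
  have : (fun n => (LaurentSeries.derivative ℚ)^[n] (0 : LaurentSeries ℚ)) = fun _ => 0 := by
    funext n
    rw [← Module.End.pow_apply, map_zero]
  rw [this, MvPolynomial.aeval_zero']

/-- The convolution unit `phi f`, with inverse `phi (-f)`. -/
noncomputable def phiUnit (f : LaurentSeries ℚ) : (WithConv (HMinus →ₗ[ℚ] LaurentSeries ℚ))ˣ where
  val := WithConv.toConv (phi f)
  inv := WithConv.toConv (phi (-f))
  val_inv := by rw [phi_convMul, add_neg_cancel, phi_zero]
  inv_val := by rw [phi_convMul, neg_add_cancel, phi_zero]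

end convolution

/-! ### Polar and regular Laurent series. -/

section polarRegular

theorem coeff_derivative_laurent (f : LaurentSeries ℚ) (n : ℤ) :
    (LaurentSeries.derivative ℚ f).coeff n = (n + 1) * f.coeff (n + 1) := by
  rw [LaurentSeries.derivative_apply, LaurentSeries.hasseDeriv_coeff]
  simp

/-- `z⁻¹ℚ[z⁻¹]`. -/
def polarSubmodule : Submodule ℚ (LaurentSeries ℚ) where
  carrier := {f | ∀ n : ℤ, 0 ≤ n → f.coeff n = 0}
  zero_mem' := fun n _ => rfl
  add_mem' := fun ha hb n hn => by rw [HahnSeries.coeff_add, ha n hn, hb n hn, add_zero]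
  smul_mem' := fun c f hf n hn => by rw [HahnSeries.coeff_smul, hf n hn, smul_zero]

theorem polarSubmodule_mul {f g : LaurentSeries ℚ} (hf : f ∈ polarSubmodule)
    (hg : g ∈ polarSubmodule) : f * g ∈ polarSubmodule := by
  intro n hn
  rw [HahnSeries.coeff_mul]
  refine Finset.sum_eq_zero fun x hx => ?_
  have hx' := (Finset.mem_antidiagonal.1 hx).2.2
  rcases le_or_gt 0 x.1 with h | h
  · rw [hf _ h, zero_mul]
  · rw [hg x.2 (by omega), mul_zero]

theorem polarSubmodule_derivative {f : LaurentSeries ℚ} (hf : f ∈ polarSubmodule) :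
    LaurentSeries.derivative ℚ f ∈ polarSubmodule := by
  intro n hn
  rw [coeff_derivative_laurent, hf _ (by omega), mul_zero]

/-- The power series `ℚ[[z]]` among the Laurent series. -/
def regularSubmodule : Submodule ℚ (LaurentSeries ℚ) where
  carrier := {f | ∀ n : ℤ, n < 0 → f.coeff n = 0}
  zero_mem' := fun n _ => rfl
  add_mem' := fun ha hb n hn => by rw [HahnSeries.coeff_add, ha n hn, hb n hn, add_zero]
  smul_mem' := fun c f hf n hn => by rw [HahnSeries.coeff_smul, hf n hn, smul_zero]

theorem regularSubmodule_mul {f g : LaurentSeries ℚ} (hf : f ∈ regularSubmodule)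
    (hg : g ∈ regularSubmodule) : f * g ∈ regularSubmodule := by
  intro n hn
  rw [HahnSeries.coeff_mul]
  refine Finset.sum_eq_zero fun x hx => ?_
  have hx' := (Finset.mem_antidiagonal.1 hx).2.2
  rcases lt_or_ge x.1 0 with h | h
  · rw [hf _ h, zero_mul]
  · rw [hg x.2 (by omega), mul_zero]

theorem regularSubmodule_derivative {f : LaurentSeries ℚ} (hf : f ∈ regularSubmodule) :
    LaurentSeries.derivative ℚ f ∈ regularSubmodule := by
  intro n hn
  rw [coeff_derivative_laurent]
  -- For `n = -1` the coefficient of `z^0` need not vanish, but it is multiplied by `n + 1 = 0`.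
  rcases eq_or_ne n (-1) with rfl | h
  · simp
  · rw [hf _ (by omega), mul_zero]

theorem eq_zero_of_polar_of_regular {f : LaurentSeries ℚ} (hp : f ∈ polarSubmodule)
    (hr : f ∈ regularSubmodule) : f = 0 := by
  ext n
  rcases lt_or_ge n 0 with h | h
  · exact hr n h
  · exact hp n h

/-- Power series contain `1` and are stable under both letters, so no word applied to `1` can leave
them. -/
theorem phi_regular {f : LaurentSeries ℚ} (hf : f ∈ regularSubmodule) (x : HMinus) :
    phi f x ∈ regularSubmodule := by
  obtain ⟨p, rfl⟩ := idealTL.mkQ_surjective x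
  rw [phi_mkQ, iterated_apply]
  refine letterAction_mem _ _ regularSubmodule (fun b hb => regularSubmodule_derivative hb)
    (fun b hb => regularSubmodule_mul hf hb) p 1 fun n hn => ?_
  rw [HahnSeries.coeff_one, if_neg hn.ne]

/-- The invariance argument cannot start at `1`, which is not polar. It starts instead at `f`, the
value of the last letter `y`. -/
theorem phi_polar {f : LaurentSeries ℚ} (hf : f ∈ polarSubmodule) {x : HMinus}
    (hx : Coalgebra.counit (R := ℚ) x = 0) : phi f x ∈ polarSubmodule := by
  obtain ⟨p, rfl⟩ := idealTL.mkQ_surjective x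
  -- In `c + u y + v d` the counit hypothesis removes `c`, and `v d` contributes nothing because `d`
  -- kills `1`. What remains is `u` acting on `f`.
  obtain ⟨c, u, v, rfl⟩ := exists_decomp p
  have hd : counitDY dd = 0 := by simp [counitDY, dd]
  have hy : counitDY yy = 0 := by simp [counitDY, yy]
  rw [counit_mk_apply, map_add, map_add, map_mul, map_mul, hd, hy, mul_zero, mul_zero, add_zero,
    add_zero, AlgHom.commutes] at hx
  obtain rfl : c = 0 := hx
  have hD1 : LaurentSeries.derivative ℚ (1 : LaurentSeries ℚ) = 0 := by
    simpa using laurent_leibniz 1 1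
  have hmem := fun b hb => letterAction_mem (LaurentSeries.derivative ℚ) (LinearMap.mulLeft ℚ f)
    polarSubmodule (fun b hb => polarSubmodule_derivative hb)
    (fun b hb => polarSubmodule_mul hf hb) u b hb
  rw [phi_mkQ, iterated_apply, map_zero, zero_add, map_add, map_mul, map_mul, letterAction_dd,
    letterAction_yy, LinearMap.add_apply, Module.End.mul_apply, Module.End.mul_apply, hD1,
    map_zero, add_zero, LinearMap.mulLeft_apply, mul_one]
  exact hmem f hf

/-- The part `f_{≥0}`, as a Laurent series. -/
noncomputable def laurentRegularPart (f : LaurentSeries ℚ) : LaurentSeries ℚ :=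
  HahnSeries.ofPowerSeries ℤ ℚ (regularPart f)

theorem coeff_laurentRegularPart (f : LaurentSeries ℚ) (n : ℤ) :
    (laurentRegularPart f).coeff n = if n < 0 then 0 else f.coeff n := by
  rw [laurentRegularPart, PowerSeries.coeff_coe, regularPart, PowerSeries.coeff_mk]
  split_ifs with h
  · rfl
  · rw [Int.natAbs_of_nonneg (not_lt.1 h)]

theorem laurentRegularPart_mem (f : LaurentSeries ℚ) :
    laurentRegularPart f ∈ regularSubmodule := fun n hn => by
  rw [coeff_laurentRegularPart, if_pos hn]

theorem sub_laurentRegularPart_mem (f : LaurentSeries ℚ) :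
    f - laurentRegularPart f ∈ polarSubmodule := fun n hn => by
  rw [HahnSeries.coeff_sub, coeff_laurentRegularPart, if_neg hn.not_gt, sub_self]

theorem derivative_ofPowerSeries (g : PowerSeries ℚ) :
    LaurentSeries.derivative ℚ (HahnSeries.ofPowerSeries ℤ ℚ g) =
      HahnSeries.ofPowerSeries ℤ ℚ (PowerSeries.derivative ℚ g) := by
  ext n
  rw [coeff_derivative_laurent, PowerSeries.coeff_coe, PowerSeries.coeff_coe]
  rcases lt_trichotomy n (-1) with h | rfl | h
  · rw [if_pos (by omega), if_pos (by omega), mul_zero]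
  -- For `n = -1` the right side has no coefficient there, and the left side carries the factor `n +
  -- 1 = 0`.
  · simp
  · lift n to ℕ using (by omega)
    rw [if_neg (by omega), if_neg (by omega), PowerSeries.coeff_derivative, Int.natAbs_natCast,
      show ((n : ℤ) + 1).natAbs = n + 1 by omega]
    push_cast
    ring

/-- Transfers the nested derivatives to `ℚ[[z]]`, in the fold form that `coeff_prod_subst` produces
for the generating function. -/
theorem phi_laurentRegularPart_dyWord (f : LaurentSeries ℚ) (l : List ℕ) :
    phi (laurentRegularPart f) (dyWord l) = HahnSeries.ofPowerSeries ℤ ℚ (l.foldr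
      (fun a q => (PowerSeries.derivative ℚ)^[a] (regularPart f * q)) 1) := by
  have hit : ∀ (k : ℕ) (g : PowerSeries ℚ), (LaurentSeries.derivative ℚ)^[k]
      (HahnSeries.ofPowerSeries ℤ ℚ g) =
        HahnSeries.ofPowerSeries ℤ ℚ ((PowerSeries.derivative ℚ)^[k] g) := by
    intro k
    induction k with
    | zero => intro g; rfl
    | succ k ih =>
      intro g
      rw [Function.iterate_succ_apply, Function.iterate_succ_apply, derivative_ofPowerSeries, ih]
  induction l with
  | nil => rw [phi_dyWord_nil, List.foldr_nil, map_one]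
  | cons k l ih =>
    rw [phi_dyWord_cons, ih, laurentRegularPart, ← map_mul, hit, List.foldr_cons]

end polarRegular

/-! ### Existence and uniqueness of the Birkhoff decomposition. -/

section birkhoff
open scoped TensorProduct

theorem isBirkhoffDecomposition_phi (f : LaurentSeries ℚ) :
    IsBirkhoffDecomposition (phi f) (phi (-(f - laurentRegularPart f)))
      (phi (laurentRegularPart f)) where
  minus_one := phi_dyWord_nil _
  minus_polar _ hx :=
    phi_polar (polarSubmodule.neg_mem (sub_laurentRegularPart_mem f)) hx
  plus_regular := phi_regular (laurentRegularPart_mem f)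
  factorization := by
    refine ⟨phiUnit (-(f - laurentRegularPart f)), rfl, ?_⟩
    -- The convolution inverse negates the series, so the two arguments add up to `f`.
    change _ = WithConv.toConv (phi (- -(f - laurentRegularPart f))) * _
    rw [phi_convMul, neg_neg, sub_add_cancel]

/-- The words of length less than `n` in the letters `d` and `y`. -/
def wordsLt (n : ℕ) : Set PolyDY :=
  {p | ∃ l : List Letter, l.length < n ∧ p = (l.map (FreeAlgebra.ι ℚ)).prod}

/-- The coproduct of a word `w` is `w ⊗ 1` up to terms with a shorter word on the left. -/
theorem coproductDY_list (l : List Letter) :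
    coproductDY (l.map (FreeAlgebra.ι ℚ)).prod - (l.map (FreeAlgebra.ι ℚ)).prod ⊗ₜ[ℚ] 1 ∈
      Submodule.span ℚ {z : PolyDY ⊗[ℚ] PolyDY | ∃ a ∈ wordsLt l.length, ∃ b, z = a ⊗ₜ b} := by
  induction l with
  | nil => simp [Algebra.TensorProduct.one_def]
  | cons x l ih =>
    set w : PolyDY := (l.map (FreeAlgebra.ι ℚ)).prod with hw
    set S := fun n : ℕ =>
      Submodule.span ℚ {z : PolyDY ⊗[ℚ] PolyDY | ∃ a ∈ wordsLt n, ∃ b, z = a ⊗ₜ b}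
    -- Multiplication by `x ⊗ 1 + 1 ⊗ x` lengthens the left word by at most one letter.
    have hmul : ∀ z ∈ S l.length, coproductDY (FreeAlgebra.ι ℚ x) * z ∈ S (l.length + 1) := by
      intro z hz
      induction hz using Submodule.span_induction with
      | mem z hz =>
        obtain ⟨a, ⟨m, hm, rfl⟩, b, rfl⟩ := hz
        rw [coproductDY, FreeAlgebra.lift_ι_apply, add_mul, Algebra.TensorProduct.tmul_mul_tmul,
          Algebra.TensorProduct.tmul_mul_tmul, one_mul, one_mul]
        refine Submodule.add_mem _ (Submodule.subset_span ⟨_, ⟨x :: m, ?_, ?_⟩, _, rfl⟩)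
          (Submodule.subset_span ⟨_, ⟨m, ?_, rfl⟩, _, rfl⟩)
        · simpa using hm
        · rw [List.map_cons, List.prod_cons]
        · omega
      | zero => rw [mul_zero]; exact Submodule.zero_mem _
      | add z z' _ _ h h' => rw [mul_add]; exact Submodule.add_mem _ h h'
      | smul c z _ h => rw [mul_smul_comm]; exact Submodule.smul_mem _ c h
    -- The product of `x ⊗ 1 + 1 ⊗ x` with `w ⊗ 1` is `xw ⊗ 1 + w ⊗ x`; the extra term has the left
    -- word `w`, which is shorter than `xw`.
    have e : coproductDY ((x :: l).map (FreeAlgebra.ι ℚ)).prod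
        - ((x :: l).map (FreeAlgebra.ι ℚ)).prod ⊗ₜ[ℚ] 1 =
        coproductDY (FreeAlgebra.ι ℚ x) * (coproductDY w - w ⊗ₜ[ℚ] 1)
          + w ⊗ₜ[ℚ] FreeAlgebra.ι ℚ x := by
      have : coproductDY (FreeAlgebra.ι ℚ x) * w ⊗ₜ[ℚ] 1 =
          (FreeAlgebra.ι ℚ x * w) ⊗ₜ[ℚ] 1 + w ⊗ₜ[ℚ] FreeAlgebra.ι ℚ x := by
        rw [coproductDY, FreeAlgebra.lift_ι_apply, add_mul, Algebra.TensorProduct.tmul_mul_tmul,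
          Algebra.TensorProduct.tmul_mul_tmul, one_mul, one_mul, mul_one]
      rw [List.map_cons, List.prod_cons, map_mul, mul_sub, this]
      abel
    rw [e, List.length_cons]
    exact Submodule.add_mem _ (hmul _ ih)
      (Submodule.subset_span ⟨w, ⟨l, Nat.lt_succ_self _, rfl⟩, _, rfl⟩)

theorem span_words_eq_top :
    Submodule.span ℚ (Set.range fun l : List Letter => (l.map (FreeAlgebra.ι ℚ)).prod) =
      (⊤ : Submodule ℚ PolyDY) := by
  rw [eq_top_iff, ← Algebra.top_toSubmodule, ← FreeAlgebra.adjoin_range_ι, Algebra.adjoin_eq_span]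
  refine Submodule.span_mono fun p hp => ?_
  obtain ⟨L, hL, rfl⟩ := Submonoid.exists_list_of_mem_closure hp
  obtain ⟨l, rfl⟩ : ∃ l : List Letter, l.map (FreeAlgebra.ι ℚ) = L :=
    (Set.range_list_map (FreeAlgebra.ι ℚ)).ge hL
  exact ⟨l, rfl⟩

/-- A polar linear map vanishing at `1` whose convolution product with a map preserving the unit
is regular is zero. -/
theorem eq_zero_of_convMul_regular (δ φ : HMinus →ₗ[ℚ] LaurentSeries ℚ)
    (hδ : ∀ x, δ x ∈ polarSubmodule) (hφ : φ (dyWord []) = 1)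
    (h : ∀ x, (WithConv.toConv δ * WithConv.toConv φ).ofConv x ∈ regularSubmodule) : δ = 0 := by
  -- Strong induction on the length. The empty word needs no separate treatment, since it has no
  -- shorter words and the error terms are then absent.
  have key : ∀ (n : ℕ) (l : List Letter), l.length < n →
      δ (idealTL.mkQ (l.map (FreeAlgebra.ι ℚ)).prod) = 0 := by
    intro n
    induction n with
    | zero => intro l hl; exact absurd hl (Nat.not_lt_zero _)
    | succ n ih =>
      intro l hl
      set w : PolyDY := (l.map (FreeAlgebra.ι ℚ)).prod with hw
      let T : PolyDY ⊗[ℚ] PolyDY →ₗ[ℚ] LaurentSeries ℚ := LinearMap.mul' ℚ (LaurentSeries ℚ) ∘ₗ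
        TensorProduct.map (δ ∘ₗ idealTL.mkQ) (φ ∘ₗ idealTL.mkQ)
      have hT : ∀ a b, T (a ⊗ₜ b) = δ (idealTL.mkQ a) * φ (idealTL.mkQ b) := fun a b => rfl
      -- All remaining terms have a shorter left word, on which `δ` vanishes by induction. Hence `(δ
      -- * φ)(w) = δ(w) φ(1) = δ(w)`.
      have hker : coproductDY w - w ⊗ₜ[ℚ] 1 ∈ LinearMap.ker T := by
        refine (Submodule.span_le.2 ?_) (coproductDY_list l)
        rintro _ ⟨a, ⟨m, hm, rfl⟩, b, rfl⟩
        change T _ = 0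
        rw [hT, ih m (by omega), zero_mul]
      rw [LinearMap.mem_ker, map_sub, sub_eq_zero, hT] at hker
      have h1 : φ (idealTL.mkQ 1) = 1 := hφ
      rw [h1, mul_one] at hker
      refine eq_zero_of_polar_of_regular (hδ _) ?_
      rw [← hker]
      have := h (idealTL.mkQ w)
      rwa [convMul_mkQ] at this
  refine LinearMap.ext fun x => ?_
  obtain ⟨p, rfl⟩ := idealTL.mkQ_surjective x
  have hp : p ∈ LinearMap.ker (δ ∘ₗ idealTL.mkQ) := by
    have : p ∈ (⊤ : Submodule ℚ PolyDY) := trivial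
    rw [← span_words_eq_top] at this
    refine (Submodule.span_le.2 ?_) this
    rintro _ ⟨l, rfl⟩
    exact key _ l (Nat.lt_succ_self _)
  exact hp

/-- Without the inverse the factorization is linear in the pair `(φm, φp)`, so two decompositions of
the same `φ` can be subtracted. -/
theorem IsBirkhoffDecomposition.convMul_eq {φ φm φp : HMinus →ₗ[ℚ] LaurentSeries ℚ}
    (h : IsBirkhoffDecomposition φ φm φp) :
    WithConv.toConv φm * WithConv.toConv φ = WithConv.toConv φp := by
  obtain ⟨u, hu, hφ⟩ := h.factorization
  rw [hφ, ← hu, ← mul_assoc, Units.mul_inv, one_mul]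

theorem IsBirkhoffDecomposition.unique {φ φm φp ψm ψp : HMinus →ₗ[ℚ] LaurentSeries ℚ}
    (hφ : φ (dyWord []) = 1) (h : IsBirkhoffDecomposition φ φm φp)
    (h' : IsBirkhoffDecomposition φ ψm ψp) : φm = ψm ∧ φp = ψp := by
  have hm : φm = ψm := by
    rw [← sub_eq_zero]
    refine eq_zero_of_convMul_regular _ φ (fun x => ?_) hφ fun x => ?_
    · have hone : Coalgebra.counit (R := ℚ) (dyWord []) = 1 := by
        change counitDY 1 = 1
        exact map_one _
      -- Polarity is assumed only on the kernel of the counit. Both maps take the value `1` at `1`,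
      -- so their difference does not change when `x` is projected to that kernel.
      have hx : Coalgebra.counit (R := ℚ)
          (x - Coalgebra.counit (R := ℚ) x • dyWord []) = 0 := by
        rw [map_sub, map_smul, hone, smul_eq_mul, mul_one, sub_self]
      have hmem := polarSubmodule.sub_mem (h.minus_polar _ hx) (h'.minus_polar _ hx)
      rw [map_sub, map_sub, map_smul, map_smul, h.minus_one, h'.minus_one,
        sub_sub_sub_cancel_right] at hmem
      exact hmem
    · have e : WithConv.toConv (φm - ψm) * WithConv.toConv φ = WithConv.toConv (φp - ψp) := by
        rw [WithConv.toConv_sub, sub_mul, h.convMul_eq, h'.convMul_eq, WithConv.toConv_sub]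
      rw [e]
      exact regularSubmodule.sub_mem (h.plus_regular x) (h'.plus_regular x)
  refine ⟨hm, WithConv.toConv_injective ?_⟩
  rw [← h.convMul_eq, ← h'.convMul_eq, hm]

end birkhoff

/-! ### The generating function: coefficients of products of substituted series. -/

section generatingFunction
open scoped Nat

variable {r : ℕ}

/-- By the power rule no power of `a` involves the variable `i`, and a coefficient of `h(a)` is a
combination of the corresponding coefficients of the powers of `a`. -/
theorem pderiv_subst_of_pderiv_eq_zero {a : MvPowerSeries (Fin r) ℚ}
    (ha : PowerSeries.HasSubst a) {i : Fin r} (h0 : MvPowerSeries.pderiv ℚ i a = 0)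
    (h : PowerSeries ℚ) : MvPowerSeries.pderiv ℚ i (h.subst a) = 0 := by
  ext m
  have hz : ∀ n : ℕ, MvPowerSeries.coeff (m + Finsupp.single i 1) (a ^ n) = 0 := by
    intro n
    have := congrArg (MvPowerSeries.coeff m) (MvPowerSeries.pderiv_pow (i := i) a n)
    rw [h0, mul_zero, MvPowerSeries.coeff_pderiv, map_zero] at this
    exact (mul_eq_zero.1 this).resolve_right (by positivity)
  rw [MvPowerSeries.coeff_pderiv, PowerSeries.coeff_subst ha]
  simp [hz]

/-- The chain rule with inner derivative one, checked coefficientwise from the rule `∂(aⁿ) = n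
aⁿ⁻¹`. -/
theorem pderiv_subst_of_pderiv_eq_one {a : MvPowerSeries (Fin r) ℚ}
    (ha : PowerSeries.HasSubst a) {i : Fin r} (h1 : MvPowerSeries.pderiv ℚ i a = 1)
    (h : PowerSeries ℚ) :
    MvPowerSeries.pderiv ℚ i (h.subst a) = (PowerSeries.derivative ℚ h).subst a := by
  ext m
  have hz : ∀ n : ℕ, MvPowerSeries.coeff (m + Finsupp.single i 1) (a ^ n) * (m i + 1) =
      n * MvPowerSeries.coeff m (a ^ (n - 1)) := by
    intro n
    rw [← MvPowerSeries.coeff_pderiv, MvPowerSeries.pderiv_pow, h1, mul_one, ← nsmul_eq_mul,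
      map_nsmul, nsmul_eq_mul]
  rw [MvPowerSeries.coeff_pderiv, PowerSeries.coeff_subst ha, PowerSeries.coeff_subst ha,
    finsum_mul]
  simp only [smul_eq_mul, mul_assoc, hz]
  -- The term of index `0` carries the factor `n = 0`, which makes the truncated exponent `n - 1`
  -- harmless; the sum can then be reindexed over successors.
  rw [← finsum_mem_univ, finsum_mem_inter_support_eq _ _ (Set.range Nat.succ) ?_,
    finsum_mem_range Nat.succ_injective]
  · refine finsum_congr fun n => ?_
    rw [PowerSeries.coeff_derivative, Nat.succ_eq_add_one, Nat.add_sub_cancel]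
    push_cast
    ring
  · ext n
    cases n with
    | zero => simp
    | succ n => simp

/-- Divisibility by `X i` expresses equality after putting `z_i = 0`. It passes from `a - b` to `aⁿ
- bⁿ`, and from there to the substituted series. -/
theorem X_dvd_subst_sub_subst {a b : MvPowerSeries (Fin r) ℚ}
    (ha : PowerSeries.HasSubst a) (hb : PowerSeries.HasSubst b) {i : Fin r}
    (hab : MvPowerSeries.X i ∣ a - b) (h : PowerSeries ℚ) :
    (MvPowerSeries.X i : MvPowerSeries (Fin r) ℚ) ∣ h.subst a - h.subst b := by
  rw [MvPowerSeries.X_dvd_iff]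
  intro m hm
  rw [map_sub, PowerSeries.coeff_subst ha, PowerSeries.coeff_subst hb, sub_eq_zero]
  refine finsum_congr fun n => ?_
  have := MvPowerSeries.X_dvd_iff.1 (hab.trans (sub_dvd_pow_sub_pow a b n)) m hm
  rw [map_sub, sub_eq_zero] at this
  rw [this]

theorem coeff_iterate_pderiv (i : Fin r) (n : ℕ) (F : MvPowerSeries (Fin r) ℚ)
    (m : Fin r →₀ ℕ) : MvPowerSeries.coeff m ((MvPowerSeries.pderiv ℚ i)^[n] F) =
      (m i + 1).ascFactorial n * MvPowerSeries.coeff (m + Finsupp.single i n) F := by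
  induction n generalizing F with
  | zero => simp
  | succ n ih =>
    rw [Function.iterate_succ_apply, ih, MvPowerSeries.coeff_pderiv, add_assoc,
      ← Finsupp.single_add, Nat.ascFactorial_succ]
    simp only [Finsupp.add_apply, Finsupp.single_eq_same]
    push_cast
    ring

/-- The linear form `z_i + ⋯ + z_r`, the variables being indexed from `0`. -/
noncomputable def tailSum (r i : ℕ) : MvPowerSeries (Fin r) ℚ :=
  ∑ j ∈ Finset.univ.filter fun j : Fin r => i ≤ (j : ℕ), MvPowerSeries.X j

theorem hasSubst_tailSum (r i : ℕ) : PowerSeries.HasSubst (tailSum r i) :=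
  PowerSeries.HasSubst.of_constantCoeff_zero (by simp [tailSum])

theorem pderiv_tailSum (i : Fin r) (n : ℕ) :
    MvPowerSeries.pderiv ℚ i (tailSum r n) = if n ≤ (i : ℕ) then 1 else 0 := by
  rw [tailSum, map_sum]
  simp only [MvPowerSeries.pderiv_X, Pi.single_apply]
  simp [Finset.sum_ite_eq']

/-- Used to see that putting `z_i = 0` turns the linear form of index `i` into the next one. -/
theorem tailSum_sub (i : Fin r) : tailSum r i - tailSum r (i + 1) = MvPowerSeries.X i := by
  have : (Finset.univ.filter fun j : Fin r => (i : ℕ) ≤ j) =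
      insert i (Finset.univ.filter fun j : Fin r => (i : ℕ) + 1 ≤ j) := by
    ext j
    simp only [Finset.mem_filter, Finset.mem_univ, true_and, Finset.mem_insert, Fin.ext_iff]
    omega
  rw [tailSum, tailSum, this, Finset.sum_insert (by simp), add_sub_cancel_right]

/-- The product `h(z_i + ⋯ + z_r) ∏_{j ≥ i} g(z_j + ⋯ + z_r)`. -/
noncomputable def tailProd (r : ℕ) (g : PowerSeries ℚ) (i : ℕ) (h : PowerSeries ℚ) : MvPowerSeries (Fin r) ℚ :=
  h.subst (tailSum r i) * ∏ j ∈ Finset.univ.filter fun j : Fin r => i ≤ (j : ℕ), g.subst (tailSum r j)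

/-- Removal of one variable. The coefficient of `z_i^n`, times `n!`, is the `n`-th derivative in
`z_i` at `z_i = 0`. Only `(g h)(z_i + ⋯ + z_r)` depends on `z_i`, so this derivative falls on `g h`
alone, and the form it is evaluated at becomes `z_{i+1} + ⋯ + z_r`. -/
theorem coeff_tailProd_succ (g h : PowerSeries ℚ) (i : Fin r) (m : Fin r →₀ ℕ) (hm : m i = 0)
    (n : ℕ) :
    MvPowerSeries.coeff (m + Finsupp.single i n) (tailProd r g i h) * n ! =
      MvPowerSeries.coeff m (tailProd r g (i + 1) ((PowerSeries.derivative ℚ)^[n] (g * h))) := by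
  set Q : MvPowerSeries (Fin r) ℚ :=
    ∏ j ∈ Finset.univ.filter fun j : Fin r => (i : ℕ) + 1 ≤ (j : ℕ), g.subst (tailSum r j) with hQ
  have hfilter : (Finset.univ.filter fun j : Fin r => (i : ℕ) ≤ j) =
      insert i (Finset.univ.filter fun j : Fin r => (i : ℕ) + 1 ≤ j) := by
    ext j
    simp only [Finset.mem_filter, Finset.mem_univ, true_and, Finset.mem_insert, Fin.ext_iff]
    omega
  have hT : tailProd r g i h = (g * h).subst (tailSum r i) * Q := by
    rw [tailProd, hfilter, Finset.prod_insert (by simp),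
      PowerSeries.subst_mul (hasSubst_tailSum r i)]
    ring
  -- The factors of index `j > i` are series in `z_j + ⋯ + z_r`, where `z_i` does not occur.
  have hpQ : MvPowerSeries.pderiv ℚ i Q = 0 := by
    rw [hQ]
    refine Finset.prod_induction _ (fun q => MvPowerSeries.pderiv ℚ i q = 0) ?_ ?_ ?_
    · intro a b ha hb
      rw [Derivation.leibniz, ha, hb, smul_zero, smul_zero, add_zero]
    · exact MvPowerSeries.pderiv_one
    · intro j hj
      refine pderiv_subst_of_pderiv_eq_zero (hasSubst_tailSum r j) ?_ g
      have : ¬ (j : ℕ) ≤ i := by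
        have := (Finset.mem_filter.1 hj).2
        omega
      rw [pderiv_tailSum, if_neg this]
  have hit : ∀ (n : ℕ) (q : PowerSeries ℚ),
      (MvPowerSeries.pderiv ℚ i)^[n] (q.subst (tailSum r i) * Q) =
        ((PowerSeries.derivative ℚ)^[n] q).subst (tailSum r i) * Q := by
    intro n
    induction n with
    | zero => intro q; rfl
    | succ n ih =>
      intro q
      rw [Function.iterate_succ_apply, Function.iterate_succ_apply, Derivation.leibniz, hpQ,
        smul_zero, zero_add, pderiv_subst_of_pderiv_eq_one (hasSubst_tailSum r i)
          (by rw [pderiv_tailSum, if_pos le_rfl]), smul_eq_mul, mul_comm Q, ih]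
  have h1 := coeff_iterate_pderiv i n (tailProd r g i h) m
  -- Since `m i = 0`, the rising factorial of `coeff_iterate_pderiv` starts at `1` and equals `n!`.
  rw [hT, hit, hm, zero_add, Nat.one_ascFactorial, ← hT] at h1
  rw [mul_comm, ← h1, tailProd, ← hQ]
  -- The monomial `m` is free of `z_i`, so its coefficient is unchanged when the argument is
  -- replaced by one that agrees with it at `z_i = 0`.
  have hd := (X_dvd_subst_sub_subst (hasSubst_tailSum r i) (hasSubst_tailSum r (i + 1)) (i := i)
    (by rw [tailSum_sub]) ((PowerSeries.derivative ℚ)^[n] (g * h))).mul_right Q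
  have := MvPowerSeries.X_dvd_iff.1 hd m hm
  rwa [sub_mul, map_sub, sub_eq_zero] at this

/-- Iterates `coeff_tailProd_succ`: the variables below `i` are already removed, `n` are left, and
`h` is the accumulator of the fold. It has to be arbitrary because every step changes it. -/
theorem coeff_tailProd (g : PowerSeries ℚ) (n i : ℕ) (hn : n + i = r) (h : PowerSeries ℚ)
    (k : Fin r →₀ ℕ) (hk : ∀ j : Fin r, (j : ℕ) < i → k j = 0) :
    MvPowerSeries.coeff k (tailProd r g i h) * ∏ j, ((k j)! : ℚ) =
      PowerSeries.constantCoeff (((List.ofFn k).drop i).foldl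
        (fun q a => (PowerSeries.derivative ℚ)^[a] (g * q)) h) := by
  induction n generalizing i h k with
  | zero =>
    obtain rfl : i = r := by omega
    obtain rfl : k = 0 := Finsupp.ext fun j => hk j j.2
    -- With no variable left, the product is empty and the linear form is the empty sum `0`, so
    -- substitution returns the constant coefficient of `h`.
    have hf : (Finset.univ.filter fun j : Fin i => i ≤ (j : ℕ)) = ∅ :=
      Finset.filter_eq_empty_iff.2 fun j _ => not_le.2 j.2
    have hd : (List.ofFn (⇑(0 : Fin i →₀ ℕ))).drop i = [] :=
      List.drop_eq_nil_of_le (by simp)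
    rw [tailProd, tailSum, hd, hf, Finset.prod_empty, Finset.sum_empty, mul_one,
      PowerSeries.subst_zero_eq_C_constantCoeff]
    simp
  | succ n ih =>
    let i' : Fin r := ⟨i, by omega⟩
    have hkd : k.erase i' + Finsupp.single i' (k i') = k := Finsupp.erase_add_single i' k
    have hne : ∀ j : Fin r, j ≠ i' → k.erase i' j = k j := fun j hj => Finsupp.erase_ne hj
    have hstep := coeff_tailProd_succ g h i' (k.erase i') Finsupp.erase_same (k i')
    rw [hkd] at hstep
    have hrec := ih (i + 1) (by omega) ((PowerSeries.derivative ℚ)^[k i'] (g * h)) (k.erase i') ?_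
    -- The erased exponent is `0` and contributes the factor `0! = 1`; the factorial split off is
    -- the one consumed by `hstep`.
    · have hprod : ∏ j, ((k j)! : ℚ) = (k i')! * ∏ j, ((k.erase i' j)! : ℚ) := by
        rw [← Finset.mul_prod_erase _ _ (Finset.mem_univ i'),
          ← Finset.mul_prod_erase _ (fun j => ((k.erase i' j)! : ℚ)) (Finset.mem_univ i'),
          Finsupp.erase_same, Nat.factorial_zero, Nat.cast_one, one_mul]
        congr 1
        exact Finset.prod_congr rfl fun j hj => by rw [hne j (Finset.ne_of_mem_erase hj)]
      -- Erasing changes only the entry at position `i`, which is dropped on the right.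
      have hlist : (List.ofFn k).drop i = k i' :: (List.ofFn (k.erase i')).drop (i + 1) := by
        rw [List.drop_eq_getElem_cons (by simp only [List.length_ofFn]; omega)]
        congr 1
        · simp [i']
        · refine List.ext_getElem (by simp) fun j h1 h2 => ?_
          simp only [List.getElem_drop, List.getElem_ofFn]
          rw [hne]
          simp only [i', ne_eq, Fin.ext_iff]
          omega
      rw [hprod, ← mul_assoc, hstep, hlist, List.foldl_cons]
      exact hrec
    · intro j hj
      by_cases hji : j = i'
      · rw [hji, Finsupp.erase_same]
      · rw [hne j hji]
        refine hk j ?_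
        have : (j : ℕ) ≠ i := fun h => hji (Fin.ext h)
        omega

/-- The case `i = 0`, `h = 1`. The variable of index `0` is removed first, so its exponent belongs
to the innermost derivative; this is why the exponents appear in reversed order in `limitValue`. -/
theorem coeff_prod_subst (g : PowerSeries ℚ) (k : Fin r →₀ ℕ) :
    MvPowerSeries.coeff k (∏ i : Fin r, g.subst
      (∑ j ∈ Finset.Ici i, (MvPowerSeries.X j : MvPowerSeries (Fin r) ℚ))) * ∏ j, ((k j)! : ℚ) =
      PowerSeries.constantCoeff ((List.ofFn k).reverse.foldr
        (fun a q => (PowerSeries.derivative ℚ)^[a] (g * q)) 1) := by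
  have h := coeff_tailProd g r 0 (add_zero r) 1 k (fun j hj => absurd hj (Nat.not_lt_zero _))
  rw [List.drop_zero, ← List.foldr_reverse] at h
  rw [← h]
  have h1 : (1 : PowerSeries ℚ).subst (tailSum r 0) = 1 := by
    rw [← PowerSeries.coe_substAlgHom (hasSubst_tailSum r 0), map_one]
  rw [tailProd, h1, one_mul]
  have hprod : (∏ i : Fin r, g.subst
      (∑ j ∈ Finset.Ici i, (MvPowerSeries.X j : MvPowerSeries (Fin r) ℚ))) =
      ∏ j ∈ Finset.univ.filter fun j : Fin r => 0 ≤ (j : ℕ), g.subst (tailSum r j) := by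
    rw [Finset.filter_true_of_mem fun j _ => Nat.zero_le _]
    refine Finset.prod_congr rfl fun i _ => ?_
    have : Finset.Ici i = Finset.univ.filter fun j : Fin r => (i : ℕ) ≤ (j : ℕ) := by
      refine Finset.ext fun j => ?_
      rw [Finset.mem_Ici, Finset.mem_filter]
      exact ⟨fun h => ⟨Finset.mem_univ _, h⟩, fun h => h.2⟩
    rw [tailSum, this]
  rw [hprod]

end generatingFunction

end ShuffleRenorm

theorem mainTheorem7 (f : LaurentSeries ℚ) :
    (∃! p : (ShuffleRenorm.HMinus →ₗ[ℚ] LaurentSeries ℚ) ×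
        (ShuffleRenorm.HMinus →ₗ[ℚ] LaurentSeries ℚ),
      ShuffleRenorm.IsBirkhoffDecomposition (ShuffleRenorm.phi f) p.1 p.2) ∧
    ∀ φm φp : ShuffleRenorm.HMinus →ₗ[ℚ] LaurentSeries ℚ,
      ShuffleRenorm.IsBirkhoffDecomposition (ShuffleRenorm.phi f) φm φp →
      ∀ r : ℕ, 1 ≤ r →
        ShuffleRenorm.genFun φp r =
          ∏ i : Fin r, (ShuffleRenorm.regularPart f).subst
            (∑ j ∈ Finset.Ici i, (MvPowerSeries.X j : MvPowerSeries (Fin r) ℚ)) := by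
  have hφ := ShuffleRenorm.isBirkhoffDecomposition_phi f
  have h1 := ShuffleRenorm.phi_dyWord_nil f
  refine ⟨⟨(_, _), hφ, fun p hp => ?_⟩, fun φm φp h r _ => ?_⟩
  · obtain ⟨hm, hp⟩ := hp.unique h1 hφ
    exact Prod.ext hm hp
  -- By uniqueness, the regular component is the explicit `phi` of the regular part of `f`.
  · rw [(h.unique h1 hφ).2]
    refine MvPowerSeries.ext fun k => ?_
    have hk : (∏ j, ((k j).factorial : ℚ)) ≠ 0 :=
      Finset.prod_ne_zero_iff.2 fun j _ => Nat.cast_ne_zero.2 (Nat.factorial_ne_zero _)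
    change ShuffleRenorm.limitValue _ k / _ = _
    rw [div_eq_iff hk, ShuffleRenorm.coeff_prod_subst, ShuffleRenorm.limitValue,
      ShuffleRenorm.phi_laurentRegularPart_dyWord, PowerSeries.coeff_coe, if_neg (lt_irrefl _),
      Int.natAbs_zero, PowerSeries.coeff_zero_eq_constantCoeff_apply]
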